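/- Let $\mathbb D$ be the open unit disc and, for $p\in(0,1)$, let $Co(p)$ be the family of functions $f:\mathbb D\to\overline{\mathbb C}$ such that (i) $f$ is meromorphic in $\mathbb D$ and has a simple pole at $p$; (ii) $f(0)=f'(0)-1=0$; (iii) $f$ maps $\mathbb D$ conformally (injectively) onto a set whose complement with respect to $\overline{\mathbb C}$ is convex. Every $f\in Co(p)$ has a Laurent expansion $$f(z)=\sum_{n=-1}^{\infty}a_n(f)(z-p)^n,\qquad 0<|z-p|<1-p.$$ Let $p\in\left(0,1-\frac{\sqrt2}{2}\right]$. Then the set of values $\{a_1(f): f\in Co(p)\}$ is exactly the closed disc of all $a_1\in\mathbb C$ with $$\left|a_1\left(\frac{1-p^2}{p}\right)^2+\frac{p^2}{1-p^4}\right|\le\frac{1}{1-p^4}.$$ Moreover, for $f\in Co(p)$, equality holds in this inequality with $a_1=a_1(f)$ if and only if there is a $\theta\in[0,2\pi]$ such that $$f(z)=\frac{z-\frac{p}{1+p^2}\left(1+e^{i\theta}\right)z^2}{\left(1-\frac zp\right)(1-zp)},\qquad z\in\mathbb D.$$ -/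

import Mathlib

noncomputable section

namespace ConcaveUnivalent

/-- The map into the Riemann sphere `OnePoint ℂ` given by a meromorphic function `f`: poles are
sent to `∞`, and every other point `z` to `f z`. -/
def toSphere (f : ℂ → ℂ) (z : ℂ) : OnePoint ℂ :=
  open Classical in if meromorphicOrderAt f z < 0 then OnePoint.infty else (f z : OnePoint ℂ)

/-- The class `Co(p)` of concave univalent functions on the open unit disc with pole `p`.
A meromorphic function on the disc is represented by a function `f : ℂ → ℂ`, whose values off
the disc play no role. Meromorphy in normal form says that `f` is analytic at each point of the
disc which is not a pole (there are no removable singularities); the associated map from the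
disc to the Riemann sphere is `toSphere f`. -/
structure IsConcave (p : ℝ) (f : ℂ → ℂ) : Prop where
  meromorphic : MeromorphicNFOn f (Metric.ball 0 1)
  simple_pole : meromorphicOrderAt f (p : ℂ) = -1
  map_zero : f 0 = 0
  deriv_zero : HasDerivAt f 1 0
  injOn : Set.InjOn (toSphere f) (Metric.ball 0 1)
  /-- The complement of the image in the Riemann sphere is a convex subset of the plane
  (it cannot contain `∞`, which is the image of `p`). -/
  convex_compl : ∃ K : Set ℂ, Convex ℝ K ∧
    (toSphere f '' Metric.ball 0 1)ᶜ = (fun w : ℂ => (w : OnePoint ℂ)) '' K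

/-- `Co(p)` as a set of functions. -/
def Co (p : ℝ) : Set (ℂ → ℂ) := {f | IsConcave p f}

/-- The Laurent coefficient `a_n(f)` at the point `p`, `0 < p < 1`, of a function holomorphic on
`0 < |z - p| < 1 - p`, by Cauchy's formula on the circle of radius `(1 - p) / 2`. -/
def laurentCoeff (p : ℝ) (n : ℤ) (f : ℂ → ℂ) : ℂ :=
  (2 * (Real.pi : ℂ) * Complex.I)⁻¹ *
    ∮ z in C((p : ℂ), (1 - p) / 2), f z / (z - (p : ℂ)) ^ (n + 1)

/-- The extremal functions, indexed by `θ`. -/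
def extremal (p θ : ℝ) (z : ℂ) : ℂ :=
  (z - (p : ℂ) / (1 + (p : ℂ) ^ 2) * (1 + Complex.exp (Complex.I * (θ : ℂ))) * z ^ 2) /
    ((1 - z / (p : ℂ)) * (1 - z * (p : ℂ)))

end ConcaveUnivalent

end

namespace ConcaveUnivalent

open Complex Metric Set Filter Topology

/-! Move the pole to the origin by `discAut p`: f becomes F(v) = b/v + G(v), univalent on the
punctured disc and omitting a convex set K. Put g = G'/b, c = g(0) and κ = 1 - p² g(-p). The
normalisation f'(0) = 1 says b κ (1 - p²) = -p², so a₁ ((1 - p²)/p)² = -c/κ.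

With X = κ + c p², the coefficient inequality reads |p² X - c| ≤ |X - c p²|, which by the identity
`normSq_sub_sub_normSq` is just |c| ≤ |X|. Since X = 1 + p² (c - g(-p)), it is enough that |v² (c -
g(v))| ≤ (1 - |c|)/2 for |v| ≤ 3/10 (`norm_sq_mul_sub_le`): then |X| ≥ (1 + |c|)/2 ≥ |c|, with
equality only if |c| = 1. The range p ≤ 1 - √2/2 lies inside p ≤ 3/10.

The estimate comes from convexity of K. The mean of two rotations of F is subordinate to F
(`OmitsConvex.norm_le_of_mean_eq`); letting the angle tend to 0 gives Re(-(1 + v F''/F')) ≥ 0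
(`OmitsConvex.re_nonneg`). A Cayley transform turns this into a differential equation for g driven
by a function ω bounded by one with ω(0) = c, and Schwarz–Pick makes ω - c small in terms of 1 -
|c|.

Conversely, if g is the constant c, then F is affine in the Joukowski map 1/v + c v, whose omitted
set is a filled ellipse. These functions form the family `parametric`, with ω = (p² - c)/(1 - c p²)
running over the closed unit disc, and their coefficients fill the asserted disc
(`laurentCoeff_of_eq_parametric`). The estimate forces g to be constant when |c| = 1, which
identifies the equality case. -/

/-! ### Univalent functions and their inverses -/

/-- An analytic function which is injective near a point has nonzero derivative there. -/
theorem deriv_ne_zero_of_injOn {f : ℂ → ℂ} {U : Set ℂ} {z₀ : ℂ} (hU : U ∈ 𝓝 z₀)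
    (hf : AnalyticAt ℂ f z₀) (hinj : InjOn f U) : deriv f z₀ ≠ 0 := by
  intro hd
  have hg : AnalyticAt ℂ (fun z => f z - f z₀) z₀ := hf.sub analyticAt_const
  have hne : analyticOrderAt (fun z => f z - f z₀) z₀ ≠ ⊤ := by
    rw [Ne, analyticOrderAt_eq_top]
    intro h
    have h1 : ∀ᶠ z in 𝓝[≠] z₀, f z - f z₀ = 0 ∧ z ∈ U ∧ z ≠ z₀ := by
      filter_upwards [h.filter_mono nhdsWithin_le_nhds, nhdsWithin_le_nhds hU,
        self_mem_nhdsWithin] with z a b c using ⟨a, b, c⟩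
    obtain ⟨z, hz, hzU, hz0⟩ := h1.exists
    exact hz0 (hinj hzU (mem_of_mem_nhds hU) (sub_eq_zero.1 hz))
  obtain ⟨g, hga, hg0, hgeq⟩ := (hg.analyticOrderAt_ne_top).1 hne
  set n := analyticOrderNatAt (fun z => f z - f z₀) z₀ with hn
  have hn0 : n ≠ 0 := by
    intro h
    have := hgeq.self_of_nhds
    simp [h] at this
    exact hg0 this.symm
  have hn1 : n ≠ 1 := by
    intro h
    have h1 : HasDerivAt (fun z => f z - f z₀) (g z₀) z₀ := by
      have h2 : HasDerivAt (fun z => (z - z₀) ^ n • g z) (g z₀) z₀ := by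
        have := ((hasDerivAt_id z₀).sub_const z₀).fun_mul hga.differentiableAt.hasDerivAt
        simpa [h] using this
      exact h2.congr_of_eventuallyEq hgeq
    have h3 := hf.differentiableAt.hasDerivAt.sub_const (f z₀)
    rw [hd] at h3
    exact hg0 (h1.unique h3)
  obtain ⟨a, ha⟩ := IsAlgClosed.exists_pow_nat_eq (g z₀) (Nat.pos_of_ne_zero hn0)
  have ha0 : a ≠ 0 := by
    rintro rfl
    rw [zero_pow hn0] at ha
    exact hg0 ha.symm
  -- `R` is a local n-th root of f - f(z₀) with nonzero derivative `a`, hence locally onto. For n ≥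
  -- 2 it takes some value y ≠ 0 and also ηy, η a primitive n-th root of unity, and f agrees at the
  -- two preimages.
  set R : ℂ → ℂ := fun z => (z - z₀) * (a * exp (log (g z / g z₀) / n)) with hR
  have hlog : AnalyticAt ℂ (fun z => a * exp (log (g z / g z₀) / n)) z₀ := by
    refine analyticAt_const.mul (AnalyticAt.cexp (AnalyticAt.div ?_ analyticAt_const
      (by exact_mod_cast hn0)))
    refine AnalyticAt.clog (hga.div analyticAt_const hg0) ?_
    rw [div_self hg0]
    simp
  have hRd : HasStrictDerivAt R a z₀ := by
    have h1 : AnalyticAt ℂ R z₀ := (analyticAt_id.sub analyticAt_const).mul hlog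
    have h2 : HasDerivAt R a z₀ := by
      have := ((hasDerivAt_id z₀).sub_const z₀).fun_mul hlog.differentiableAt.hasDerivAt
      simpa [hR, div_self hg0] using this
    have h3 := h1.hasStrictDerivAt
    rwa [h2.deriv] at h3
  have hmap := hRd.map_nhds_eq ha0
  have hR0 : R z₀ = 0 := by simp [hR]
  rw [hR0] at hmap
  have hpow : ∀ᶠ z in 𝓝 z₀, f z - f z₀ = R z ^ n := by
    have hgne : ∀ᶠ z in 𝓝 z₀, g z ≠ 0 := hga.continuousAt.eventually_ne hg0
    filter_upwards [hgeq, hgne] with z hz hgz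
    rw [hz, hR]
    simp only [smul_eq_mul, mul_pow]
    rw [ha, ← Complex.exp_nat_mul, mul_div_cancel₀ _ (by exact_mod_cast hn0),
      Complex.exp_log (div_ne_zero hgz hg0), mul_div_cancel₀ _ hg0]
  have hS : R '' {z | z ∈ U ∧ f z - f z₀ = R z ^ n} ∈ 𝓝 (0 : ℂ) := by
    rw [← hmap]
    exact image_mem_map (Filter.inter_mem hU hpow)
  set η : ℂ := exp (2 * Real.pi * I / n) with hη
  have hprim : IsPrimitiveRoot η n := Complex.isPrimitiveRoot_exp n hn0
  have hS2 : ∀ᶠ y in 𝓝 (0 : ℂ), η * y ∈ R '' {z | z ∈ U ∧ f z - f z₀ = R z ^ n} := by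
    have : Tendsto (fun y : ℂ => η * y) (𝓝 0) (𝓝 0) := by
      have := (by fun_prop : Continuous fun y : ℂ => η * y).tendsto 0
      simpa only [mul_zero] using this
    exact this.eventually hS
  have hall : ∀ᶠ y in 𝓝[≠] (0 : ℂ), y ∈ R '' {z | z ∈ U ∧ f z - f z₀ = R z ^ n} ∧
      η * y ∈ R '' {z | z ∈ U ∧ f z - f z₀ = R z ^ n} ∧ y ≠ 0 := by
    filter_upwards [nhdsWithin_le_nhds hS, hS2.filter_mono nhdsWithin_le_nhds,
      self_mem_nhdsWithin] with y a b c using ⟨a, b, c⟩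
  obtain ⟨y, ⟨z₁, ⟨hz₁, h₁⟩, rfl⟩, ⟨z₂, ⟨hz₂, h₂⟩, h₃⟩, hy⟩ := hall.exists
  have hff : f z₁ = f z₂ := by
    rw [h₃, mul_pow, hprim.pow_eq_one, one_mul, ← h₁] at h₂
    exact (sub_left_injective h₂).symm
  have := hinj hz₁ hz₂ hff
  subst this
  have h4 : η = 1 := mul_right_cancel₀ hy (by rw [← h₃, one_mul])
  exact hprim.ne_one (by omega) h4

/-- The inverse of an injective analytic function on an open set is analytic on its image,
which is open. -/
theorem exists_analytic_inverse {f : ℂ → ℂ} {U : Set ℂ} (hU : IsOpen U)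
    (hf : AnalyticOnNhd ℂ f U) (hinj : InjOn f U) :
    IsOpen (f '' U) ∧ ∃ g : ℂ → ℂ, AnalyticOnNhd ℂ g (f '' U) ∧ (∀ z ∈ U, g (f z) = z) := by
  have hopen : IsOpen (f '' U) := by
    rw [isOpen_iff_mem_nhds]
    rintro _ ⟨z, hz, rfl⟩
    have hz' := deriv_ne_zero_of_injOn (hU.mem_nhds hz) (hf z hz) hinj
    rw [← (hf z hz).hasStrictDerivAt.map_nhds_eq hz']
    exact image_mem_map (hU.mem_nhds hz)
  refine ⟨hopen, Function.invFunOn f U, ?_, fun z hz => hinj.leftInvOn_invFunOn hz⟩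
  rintro _ ⟨z, hz, rfl⟩
  rw [← analyticAt_comp_iff_of_deriv_ne_zero (hf z hz)
    (deriv_ne_zero_of_injOn (hU.mem_nhds hz) (hf z hz) hinj)]
  refine (analyticAt_id (z := z)).congr ?_
  filter_upwards [hU.mem_nhds hz] with x hx
  exact (hinj.leftInvOn_invFunOn hx).symm

/-! ### Convex omitted sets and subordination -/

/-- `v ↦ Φ v / v` is a univalent function on the unit disc with a simple pole at the origin which
omits exactly the points of the convex set `K`. -/
structure OmitsConvex (Φ : ℂ → ℂ) (K : Set ℂ) : Prop where
  analytic : AnalyticOnNhd ℂ Φ (ball 0 1)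
  ne_zero : Φ 0 ≠ 0
  injOn : InjOn (fun v => Φ v / v) (ball 0 1 \ {0})
  convex : Convex ℝ K
  image_eq : (fun v => Φ v / v) '' (ball 0 1 \ {0}) = Kᶜ

namespace OmitsConvex

variable {Φ : ℂ → ℂ} {K : Set ℂ}

theorem isOpen_punctured : IsOpen (ball (0 : ℂ) 1 \ {0}) :=
  isOpen_ball.sdiff isClosed_singleton

theorem analytic_div (h : OmitsConvex Φ K) :
    AnalyticOnNhd ℂ (fun v => Φ v / v) (ball 0 1 \ {0}) := fun v hv =>
  (h.analytic v hv.1).div analyticAt_id hv.2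

theorem notMem (h : OmitsConvex Φ K) {v : ℂ} (hv : v ∈ ball (0 : ℂ) 1) (hv0 : v ≠ 0) :
    Φ v / v ∉ K := by
  have : Φ v / v ∈ Kᶜ := h.image_eq ▸ mem_image_of_mem _ ⟨hv, hv0⟩
  exact this

theorem exists_eq (h : OmitsConvex Φ K) {y : ℂ} (hy : y ∉ K) :
    ∃ v ∈ ball (0 : ℂ) 1, v ≠ 0 ∧ Φ v / v = y := by
  have : y ∈ Kᶜ := hy
  rw [← h.image_eq] at this
  obtain ⟨v, hv, rfl⟩ := this
  exact ⟨v, hv.1, hv.2, rfl⟩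

/-- Liouville: if nothing were omitted, the inverse of Φ(v)/v would be a bounded entire function,
hence constant. -/
theorem nonempty (h : OmitsConvex Φ K) : K.Nonempty := by
  by_contra hK
  rw [not_nonempty_iff_eq_empty] at hK
  obtain ⟨-, g, hg, hgi⟩ := exists_analytic_inverse isOpen_punctured h.analytic_div h.injOn
  have himg := h.image_eq
  rw [hK, compl_empty] at himg
  have hgd : Differentiable ℂ g := fun y => (hg y (himg ▸ mem_univ y)).differentiableAt
  have hb : Bornology.IsBounded (range g) := by
    refine isBounded_ball.subset (s := range g) (t := ball (0 : ℂ) 1) ?_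
    rintro _ ⟨y, rfl⟩
    obtain ⟨v, hv, rfl⟩ : y ∈ (fun v => Φ v / v) '' (ball 0 1 \ {0}) := himg ▸ mem_univ y
    rw [hgi v hv]
    exact hv.1
  have hm : ∀ r : ℝ, 0 < r → r < 1 → (r : ℂ) ∈ ball (0 : ℂ) 1 \ {0} := fun r h0 h1 =>
    ⟨by simp [abs_of_pos h0, h1], by simpa using h0.ne'⟩
  have h1 := hgi _ (hm (1 / 2) (by norm_num) (by norm_num))
  have h2 := hgi _ (hm (1 / 3) (by norm_num) (by norm_num))
  have h3 := hgd.apply_eq_apply_of_bounded hb (Φ ((1 / 2 : ℝ) : ℂ) / ((1 / 2 : ℝ) : ℂ))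
    (Φ ((1 / 3 : ℝ) : ℂ) / ((1 / 3 : ℝ) : ℂ))
  rw [h1, h2] at h3
  norm_num at h3

theorem denom_ne_zero (h : OmitsConvex Φ K) {κ v : ℂ} (hκ : κ ∈ K) (hv : v ∈ ball (0 : ℂ) 1) :
    Φ v - κ * v ≠ 0 := by
  rcases eq_or_ne v 0 with rfl | hv0
  · simpa using h.ne_zero
  · intro h0
    refine h.notMem hv hv0 ?_
    rwa [sub_eq_zero.1 h0, mul_div_cancel_right₀ _ hv0]

/-- This is 1/(F - κ) for F = Φ(v)/v. Subtracting an omitted value κ and inverting removes the pole,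
so the origin needs no separate treatment when inverting F. -/
theorem analytic_inv (h : OmitsConvex Φ K) {κ : ℂ} (hκ : κ ∈ K) :
    AnalyticOnNhd ℂ (fun v => v / (Φ v - κ * v)) (ball 0 1) := fun v hv =>
  analyticAt_id.div ((h.analytic v hv).sub (analyticAt_const.mul analyticAt_id))
    (h.denom_ne_zero hκ hv)

theorem mul_eq_mul_iff {a b v w κ : ℂ} (ha : a - κ * v ≠ 0) (hb : b - κ * w ≠ 0) :
    v / (a - κ * v) = w / (b - κ * w) ↔ w * a = v * b := by
  rw [div_eq_div_iff ha hb]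
  constructor <;> intro h <;> linear_combination -h

theorem injOn_inv (h : OmitsConvex Φ K) {κ : ℂ} (hκ : κ ∈ K) :
    InjOn (fun v => v / (Φ v - κ * v)) (ball 0 1) := by
  intro v hv w hw hvw
  have hcross := (mul_eq_mul_iff (h.denom_ne_zero hκ hv) (h.denom_ne_zero hκ hw)).1 hvw
  rcases eq_or_ne v 0 with rfl | hv0
  · rcases mul_eq_zero.1 (hcross.trans (zero_mul _)) with h0 | h0
    · exact h0.symm
    · exact absurd h0 h.ne_zero
  rcases eq_or_ne w 0 with rfl | hw0
  · rcases mul_eq_zero.1 (hcross.symm.trans (zero_mul _)) with h0 | h0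
    · exact h0
    · exact absurd h0 h.ne_zero
  refine h.injOn ⟨hv, hv0⟩ ⟨hw, hw0⟩ ?_
  simp only
  rw [div_eq_div_iff hv0 hw0]
  linear_combination hcross

/-- Along an ultrafilter converging to a boundary point, the values accumulate in `K`. -/
theorem tendsto_mem_of_boundary (h : OmitsConvex Φ K) (𝒰 : Ultrafilter ℂ) {v₀ : ℂ}
    (hv₀ : ‖v₀‖ = 1) (hle : (𝒰 : Filter ℂ) ≤ 𝓝 v₀) (hD : ∀ᶠ v in (𝒰 : Filter ℂ), v ∈ ball (0 : ℂ) 1) :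
    ∃ x ∈ K, Tendsto (fun v => Φ v / v) 𝒰 (𝓝 x) := by
  obtain ⟨κ, hκ⟩ := h.nonempty
  have hv₀0 : v₀ ≠ 0 := by rintro rfl; simp at hv₀
  have hne : ∀ᶠ v in (𝒰 : Filter ℂ), v ≠ 0 := hle (isOpen_ne.mem_nhds hv₀0)
  by_cases hb : ∃ R : ℝ, ∀ᶠ v in (𝒰 : Filter ℂ), ‖Φ v / v‖ ≤ R
  · obtain ⟨R, hR⟩ := hb
    have hmem : closedBall (0 : ℂ) R ∈ (𝒰.map fun v => Φ v / v) := by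
      refine Ultrafilter.mem_map.2 (mem_of_superset hR fun v hv => ?_)
      simpa using hv
    obtain ⟨x, -, hx⟩ := (isCompact_closedBall (0 : ℂ) R).ultrafilter_le_nhds' _ hmem
    have hx' : Tendsto (fun v => Φ v / v) 𝒰 (𝓝 x) := hx
    refine ⟨x, ?_, hx'⟩
    by_contra hxK
    obtain ⟨w, hw, hw0, rfl⟩ := h.exists_eq hxK
    obtain ⟨-, g, hg, hgi⟩ := exists_analytic_inverse isOpen_punctured h.analytic_div h.injOn
    have hgc := (hg _ (mem_image_of_mem _ ⟨hw, hw0⟩)).continuousAt.tendsto.comp hx'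
    have hgw := hgi w ⟨hw, hw0⟩
    rw [hgw] at hgc
    have hid : Tendsto (fun v : ℂ => v) 𝒰 (𝓝 w) := by
      refine hgc.congr' ?_
      filter_upwards [hD, hne] with v hv hv0 using hgi v ⟨hv, hv0⟩
    have : w = v₀ := tendsto_nhds_unique hid hle
    rw [← this] at hv₀
    simp [hv₀] at hw
  -- If F is unbounded along an ultrafilter, it tends to ∞. Then 1/(F - κ) tends to 0, and its
  -- continuous inverse sends v to 0 rather than to the boundary.
  · exfalso
    push Not at hb
    have hcob : Tendsto (fun v => Φ v / v) 𝒰 (Bornology.cobounded ℂ) := by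
      rw [← tendsto_norm_atTop_iff_cobounded, Filter.tendsto_atTop]
      intro R
      filter_upwards [hb R] with v hv using hv.le
    have hcob' : Tendsto (fun v => Φ v / v - κ) 𝒰 (Bornology.cobounded ℂ) := by
      rw [← tendsto_norm_atTop_iff_cobounded] at hcob ⊢
      refine tendsto_atTop_mono (fun v => norm_sub_norm_le _ _) ?_
      exact tendsto_atTop_add_const_right _ _ hcob
    have hq := tendsto_inv₀_cobounded.comp hcob'
    obtain ⟨-, g, hg, hgi⟩ := exists_analytic_inverse isOpen_ball (h.analytic_inv hκ) (h.injOn_inv hκ)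
    have h0 := hgi 0 (by simp)
    have hg0 := (hg _ (mem_image_of_mem _ (mem_ball_self one_pos))).continuousAt.tendsto
    rw [h0] at hg0
    simp only [zero_div] at hg0
    have hid : Tendsto (fun v : ℂ => v) 𝒰 (𝓝 0) := by
      refine (hg0.comp hq).congr' ?_
      filter_upwards [hD, hne] with v hv hv0
      have := hgi v hv
      simp only [Function.comp]
      rw [← this]
      congr 1
      rw [this]
      have := h.denom_ne_zero hκ hv
      rw [div_sub' hv0, inv_div, mul_comm v κ]
    exact hv₀0 (tendsto_nhds_unique (show Tendsto (fun v : ℂ => v) 𝒰 (𝓝 v₀) from hle) hid)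

/-- Subordination for the mean of two rotations: if the mean of the values at the points `a v`,
`b v` of a circle is attained at `w`, then `w` lies on or outside that circle. -/
theorem norm_le_of_mean_eq (h : OmitsConvex Φ K) {a b : ℂ} (ha : ‖a‖ = 1) (hb : ‖b‖ = 1)
    (hab : a + b ≠ 0) {v₀ w₀ : ℂ} (hv₀ : v₀ ∈ ball (0 : ℂ) 1) (hv₀0 : v₀ ≠ 0)
    (hw₀ : w₀ ∈ ball (0 : ℂ) 1) (hw₀0 : w₀ ≠ 0)
    (heq : (Φ (a * v₀) / (a * v₀) + Φ (b * v₀) / (b * v₀)) / 2 = Φ w₀ / w₀) : ‖v₀‖ ≤ ‖w₀‖ := by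
  obtain ⟨κ, hκ⟩ := h.nonempty
  have ha0 : a ≠ 0 := by rintro rfl; simp at ha
  have hb0 : b ≠ 0 := by rintro rfl; simp at hb
  have hmul : ∀ c : ℂ, ‖c‖ = 1 → ∀ v ∈ ball (0 : ℂ) 1, c * v ∈ ball (0 : ℂ) 1 := by
    intro c hc v hv
    simpa [hc] using hv
  obtain ⟨hQo, g, hg, hgi⟩ :=
    exists_analytic_inverse isOpen_ball (h.analytic_inv hκ) (h.injOn_inv hκ)
  set Q : ℂ → ℂ := fun v => v / (Φ v - κ * v) with hQ
  set ΦA : ℂ → ℂ := fun v => (Φ (a * v) / a + Φ (b * v) / b) / 2 with hΦA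
  have hΦAd : ∀ v ∈ ball (0 : ℂ) 1, AnalyticAt ℂ ΦA v := by
    intro v hv
    have h1 : AnalyticAt ℂ (fun v => Φ (a * v)) v :=
      (h.analytic _ (hmul a ha v hv)).fun_comp (analyticAt_const.mul analyticAt_id)
    have h2 : AnalyticAt ℂ (fun v => Φ (b * v)) v :=
      (h.analytic _ (hmul b hb v hv)).fun_comp (analyticAt_const.mul analyticAt_id)
    exact ((h1.div analyticAt_const ha0).add (h2.div analyticAt_const hb0)).div
      analyticAt_const two_ne_zero
  have hΦA0 : ΦA 0 ≠ 0 := by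
    have : ΦA 0 = Φ 0 * (a + b) / (2 * a * b) := by
      simp only [hΦA, mul_zero]
      field_simp
      ring
    rw [this]
    exact div_ne_zero (mul_ne_zero h.ne_zero hab) (by simp [ha0, hb0])
  have hmean : ∀ v, v ≠ 0 → (Φ (a * v) / (a * v) + Φ (b * v) / (b * v)) / 2 = ΦA v / v := by
    intro v hv
    simp only [hΦA]
    field_simp
  set V : Set ℂ := {v | v ∈ ball (0 : ℂ) 1 ∧ ΦA v - κ * v ≠ 0} with hV
  have hVo : IsOpen V := by
    have : ContinuousOn (fun v => ΦA v - κ * v) (ball 0 1) := fun v hv =>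
      ((hΦAd v hv).continuousAt.sub (by fun_prop)).continuousWithinAt
    exact this.isOpen_inter_preimage isOpen_ball isOpen_ne
  set QA : ℂ → ℂ := fun v => v / (ΦA v - κ * v) with hQA
  have hQAd : ∀ v ∈ V, AnalyticAt ℂ QA v := fun v hv =>
    analyticAt_id.div ((hΦAd v hv.1).sub (analyticAt_const.mul analyticAt_id)) hv.2
  set U : Set ℂ := V ∩ QA ⁻¹' (Q '' ball 0 1) with hU
  have hUo : IsOpen U := by
    have : ContinuousOn QA V := fun v hv => (hQAd v hv).continuousAt.continuousWithinAt
    exact this.isOpen_inter_preimage hVo hQo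
  -- ψ is F⁻¹ composed with the mean of the two rotations, on the set where this makes sense. Below,
  -- φ = v/ψ(v), written without the removable singularity at 0; the claim is |φ| ≤ 1.
  set ψ : ℂ → ℂ := fun v => g (QA v) with hψ
  have hψD : ∀ v ∈ U, ψ v ∈ ball (0 : ℂ) 1 ∧ Q (ψ v) = QA v := by
    rintro v ⟨-, w, hw, hwv⟩
    have : ψ v = w := by rw [hψ]; simp only; rw [← hwv, hgi w hw]
    rw [this]
    exact ⟨hw, hwv⟩
  have hψrel : ∀ v ∈ U, ψ v * ΦA v = v * Φ (ψ v) := by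
    intro v hv
    obtain ⟨h1, h2⟩ := hψD v hv
    exact (mul_eq_mul_iff hv.1.2 (h.denom_ne_zero hκ h1)).1 h2.symm
  have hψd : ∀ v ∈ U, AnalyticAt ℂ ψ v := fun v hv => (hg _ hv.2).fun_comp (hQAd v hv.1)
  set φ : ℂ → ℂ := fun v => (ΦA v - κ * v) / (Φ (ψ v) - κ * ψ v) with hφ
  have hφd : ∀ v ∈ U, AnalyticAt ℂ φ v := fun v hv =>
    ((hΦAd v hv.1.1).sub (analyticAt_const.mul analyticAt_id)).div
      (((h.analytic _ (hψD v hv).1).fun_comp (hψd v hv)).sub (analyticAt_const.mul (hψd v hv)))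
      (h.denom_ne_zero hκ (hψD v hv).1)
  have hφψ : ∀ v ∈ U, φ v * ψ v = v := by
    intro v hv
    have := h.denom_ne_zero hκ (hψD v hv).1
    rw [hφ]
    simp only
    rw [div_mul_eq_mul_div, div_eq_iff this]
    linear_combination hψrel v hv
  have hmemU : ∀ v ∈ ball (0 : ℂ) 1, v ≠ 0 → ∀ w ∈ ball (0 : ℂ) 1, w ≠ 0 → w * ΦA v = v * Φ w →
      v ∈ U ∧ ψ v = w := by
    intro v hv hv0 w hw hw0 hvw
    have h1 : ΦA v - κ * v ≠ 0 := by
      intro h0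
      refine h.denom_ne_zero hκ hw (mul_left_cancel₀ hv0 ?_)
      linear_combination w * h0 - hvw
    have h2 : QA v = Q w := (mul_eq_mul_iff h1 (h.denom_ne_zero hκ hw)).2 hvw
    refine ⟨⟨⟨hv, h1⟩, w, hw, h2.symm⟩, ?_⟩
    rw [hψ]; simp only
    rw [h2, hgi w hw]
  have h0U : (0 : ℂ) ∈ U := by
    refine ⟨⟨by simp, by simpa using hΦA0⟩, 0, by simp, ?_⟩
    simp [hQ, hQA]
  rw [hmean v₀ hv₀0, div_eq_div_iff hv₀0 hw₀0] at heq
  obtain ⟨hv₀U, hψ₀⟩ := hmemU v₀ hv₀ hv₀0 w₀ hw₀ hw₀0 (by linear_combination heq)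
  by_contra! hlt
  have hw₀n : 0 < ‖w₀‖ := norm_pos_iff.2 hw₀0
  have hφ₀ : 1 < ‖φ v₀‖ := by
    have := hφψ v₀ hv₀U
    rw [hψ₀] at this
    have h2 : ‖φ v₀‖ * ‖w₀‖ = ‖v₀‖ := by rw [← norm_mul, this]
    by_contra! h3
    nlinarith
  obtain ⟨l, hl1, hl⟩ := exists_between hφ₀
  set W : Set ℂ := {v | v ∈ U ∧ l < ‖φ v‖} with hW
  have hWo : IsOpen W := by
    have : ContinuousOn (fun v => ‖φ v‖) U := fun v hv =>
      (hφd v hv).continuousAt.norm.continuousWithinAt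
    exact this.isOpen_inter_preimage hUo isOpen_Ioi
  have hWD : W ⊆ ball (0 : ℂ) 1 := fun v hv => hv.1.1.1
  -- On W one has |ψ| ≤ |v|/l, so limits of ψ stay in the open disc. At a point with |v| = 1 the
  -- mean would tend to a midpoint of two points of K, which lies in K by convexity, and also to
  -- F(w) with |w| < 1 or to ∞: impossible. So W does not reach the unit circle, and the maximum
  -- principle applies to φ on W.
  have hcl : closure W ⊆ U := by
    intro v hv
    obtain ⟨𝒰, hW𝒰, h𝒰⟩ := mem_closure_iff_ultrafilter.1 hv
    have hvid : Tendsto (fun v : ℂ => v) 𝒰 (𝓝 v) := h𝒰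
    have hψb : ∀ v ∈ W, l * ‖ψ v‖ ≤ ‖v‖ := by
      intro v hv
      calc l * ‖ψ v‖ ≤ ‖φ v‖ * ‖ψ v‖ := by gcongr; exact hv.2.le
        _ = ‖v‖ := by rw [← norm_mul, hφψ v hv.1]
    have hmem : closedBall (0 : ℂ) (1 / l) ∈ 𝒰.map ψ := by
      refine Ultrafilter.mem_map.2 (mem_of_superset hW𝒰 fun u hu => ?_)
      have h1 := hψb u hu
      have h2 := mem_ball_zero_iff.1 (hWD hu)
      rw [mem_preimage, mem_closedBall_zero_iff, le_div_iff₀ (by linarith)]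
      linarith
    obtain ⟨w, hw, hψw⟩ := (isCompact_closedBall (0 : ℂ) (1 / l)).ultrafilter_le_nhds' _ hmem
    have hψw' : Tendsto ψ 𝒰 (𝓝 w) := hψw
    have hwD : w ∈ ball (0 : ℂ) 1 := by
      rw [mem_closedBall_zero_iff] at hw
      rw [mem_ball_zero_iff]
      exact hw.trans_lt ((div_lt_one (by linarith)).2 hl1)
    have hΦw : Tendsto (fun u => Φ (ψ u)) 𝒰 (𝓝 (Φ w)) :=
      (h.analytic w hwD).continuousAt.tendsto.comp hψw'
    have hv1 : ‖v‖ ≤ 1 := by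
      have := closure_mono hWD hv
      rw [closure_ball _ one_ne_zero] at this
      simpa using this
    rcases hv1.lt_or_eq with hv1 | hv1
    · rcases eq_or_ne v 0 with rfl | hv0
      · exact h0U
      have hvD : v ∈ ball (0 : ℂ) 1 := by simpa using hv1
      have hlim1 := hψw'.mul ((hΦAd v hvD).continuousAt.tendsto.comp hvid)
      have hlim2 := hvid.mul hΦw
      have hrel : w * ΦA v = v * Φ w := by
        refine tendsto_nhds_unique (hlim1.congr' ?_) hlim2
        filter_upwards [hW𝒰] with u hu using hψrel u hu.1
      have hw0 : w ≠ 0 := by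
        rintro rfl
        rw [zero_mul] at hrel
        exact mul_ne_zero hv0 h.ne_zero hrel.symm
      exact (hmemU v hvD hv0 w hwD hw0 hrel).1
    · exfalso
      have hv0 : v ≠ 0 := by rintro rfl; simp at hv1
      have hrot : ∀ c : ℂ, ‖c‖ = 1 →
          ∃ x ∈ K, Tendsto (fun u => Φ (c * u) / (c * u)) 𝒰 (𝓝 x) := by
        intro c hc
        have hcont : Tendsto (fun u : ℂ => c * u) 𝒰 (𝓝 (c * v)) := tendsto_const_nhds.mul hvid
        obtain ⟨x, hx, hx'⟩ := h.tendsto_mem_of_boundary (𝒰.map fun u => c * u) (v₀ := c * v)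
          (by simp [hc, hv1]) hcont (by
            rw [Ultrafilter.coe_map, eventually_map]
            filter_upwards [hW𝒰] with u hu using hmul c hc u (hWD hu))
        rw [Ultrafilter.coe_map, tendsto_map'_iff] at hx'
        exact ⟨x, hx, hx'⟩
      obtain ⟨x, hx, hx'⟩ := hrot a ha
      obtain ⟨y, hy, hy'⟩ := hrot b hb
      have hxy : (x + y) / 2 ∈ K := by
        have := h.convex hx hy (a := 1 / 2) (b := 1 / 2) (by norm_num) (by norm_num) (by norm_num)
        convert this using 1
        simp only [Complex.real_smul]
        push_cast
        ring
      have hprod := hψw'.mul ((hx'.add hy').div_const 2)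
      have hrel : w * ((x + y) / 2) = Φ w := by
        refine tendsto_nhds_unique (hprod.congr' ?_) hΦw
        filter_upwards [hW𝒰, h𝒰 (isOpen_ne.mem_nhds hv0)] with u hu hu0
        rw [hmean u hu0, ← mul_div_assoc, div_eq_iff hu0, hψrel u hu.1]
        ring
      rcases eq_or_ne w 0 with rfl | hw0
      · rw [zero_mul] at hrel
        exact h.ne_zero hrel.symm
      · refine h.notMem hwD hw0 ?_
        rwa [← hrel, mul_div_cancel_left₀ _ hw0]
  have hfr : ∀ z ∈ frontier W, ‖φ z‖ ≤ l := by
    intro z hz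
    rw [hWo.frontier_eq] at hz
    by_contra! h1
    exact hz.2 ⟨hcl hz.1, h1⟩
  have hdiff : DiffContOnCl ℂ φ W := DifferentiableOn.diffContOnCl fun z hz =>
    (hφd z (hcl hz)).differentiableAt.differentiableWithinAt
  have := Complex.norm_le_of_forall_mem_frontier_norm_le (isBounded_ball.subset hWD) hdiff hfr
    (subset_closure (show v₀ ∈ W from ⟨hv₀U, hl⟩))
  linarith

end OmitsConvex

/-! ### From subordination to a differential inequality -/

/-- The symmetric second difference quotient of an analytic function tends to half its second
derivative. -/
theorem tendsto_symmetric_difference {f : ℂ → ℂ} (hf : AnalyticAt ℂ f 0) :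
    Tendsto (fun t : ℂ => ((f t + f (-t)) / 2 - f 0) / t ^ 2) (𝓝[≠] 0)
      (𝓝 (deriv (deriv f) 0 / 2)) := by
  have h1 := hf.hasFPowerSeriesAt.isBigO_sub_partialSum_pow 3
  simp only [FormalMultilinearSeries.partialSum, Finset.sum_range_succ, Finset.sum_range_zero,
    FormalMultilinearSeries.ofScalars_apply_eq, zero_add, iteratedDeriv_succ, iteratedDeriv_zero,
    smul_eq_mul, pow_zero, mul_one, pow_one, Nat.factorial] at h1
  have h2 := h1.comp_tendsto (show Tendsto (fun t : ℂ => -t) (𝓝 0) (𝓝 0) by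
    simpa using (continuous_neg (G := ℂ)).tendsto 0)
  have h3 : (fun t : ℂ => (f t + f (-t)) / 2 - f 0 - deriv (deriv f) 0 / 2 * t ^ 2)
      =O[𝓝 0] fun t => ‖t‖ ^ 3 := by
    have h4 := (h1.add (h2.trans (by simp [Function.comp_def, Asymptotics.isBigO_refl]))).const_mul_left
      (1 / 2)
    refine h4.congr_left fun t => ?_
    simp only [Function.comp]
    push_cast
    ring
  have h5 := h3.trans_isLittleO (g := fun t : ℂ => ‖t‖ ^ 3) (k := fun t : ℂ => t ^ 2) (by
    have := Asymptotics.isLittleO_pow_pow (𝕜 := ℂ) (show 2 < 3 by norm_num)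
    exact this.norm_left.congr_left fun t => norm_pow t 3)
  have h6 := (h5.tendsto_div_nhds_zero.mono_left (nhdsWithin_le_nhds (s := {0}ᶜ))).add_const
    (deriv (deriv f) 0 / 2)
  rw [zero_add] at h6
  refine h6.congr' ?_
  filter_upwards [self_mem_nhdsWithin] with t ht
  have : t ≠ 0 := ht
  field_simp
  ring

/-- Differentiation in the angle acts as I·v·d/dv; applied twice it is -(v d/dv)². -/
theorem deriv_deriv_comp_rotation {F : ℂ → ℂ} {v : ℂ} (hF : AnalyticAt ℂ F v) :
    deriv (deriv fun t : ℂ => F (exp (I * t) * v)) 0 =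
      -(v * deriv F v + v ^ 2 * deriv (deriv F) v) := by
  have hrot : ∀ t : ℂ, HasDerivAt (fun t : ℂ => exp (I * t) * v) (I * exp (I * t) * v) t := by
    intro t
    have h1 : HasDerivAt (fun t : ℂ => I * t) I t := by
      simpa using (hasDerivAt_id t).const_mul I
    exact (h1.cexp.mul_const v).congr_deriv (by ring)
  have hc : Tendsto (fun t : ℂ => exp (I * t) * v) (𝓝 0) (𝓝 v) := by
    have := (hrot 0).continuousAt.tendsto
    simpa using this
  have h1 : deriv (fun t : ℂ => F (exp (I * t) * v)) =ᶠ[𝓝 0]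
      fun t => deriv F (exp (I * t) * v) * (I * exp (I * t) * v) := by
    filter_upwards [hc.eventually hF.eventually_analyticAt] with t ht
    exact (ht.differentiableAt.hasDerivAt.comp t (hrot t)).deriv
  rw [h1.deriv_eq]
  have hF' : HasDerivAt (deriv F) (deriv (deriv F) v) (exp (I * 0) * v) := by
    simpa using hF.deriv.differentiableAt.hasDerivAt
  have h2 := (hF'.comp (0 : ℂ) (hrot 0)).fun_mul (((hrot 0).const_mul I))
  have h3 : HasDerivAt (fun t => deriv F (exp (I * t) * v) * (I * exp (I * t) * v)) _ 0 :=
    h2.congr_of_eventuallyEq (Eventually.of_forall fun t => by simp only [Function.comp]; ring)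
  rw [h3.deriv]
  simp only [Function.comp, mul_zero, exp_zero, one_mul, mul_one]
  linear_combination (deriv (deriv F) v * v ^ 2 + deriv F v * v) * I_sq

theorem deriv_nonneg_of_forall_ge {f : ℝ → ℝ} {f' : ℝ} (hf : HasDerivWithinAt f f' (Ici 0) 0)
    (h : ∀ᶠ x in 𝓝[>] (0 : ℝ), f 0 ≤ f x) : 0 ≤ f' := by
  have h1 := (hasDerivWithinAt_iff_tendsto_slope' (by simp)).1 hf.Ioi_of_Ici
  refine ge_of_tendsto h1 ?_
  filter_upwards [h, self_mem_nhdsWithin] with x hx hx0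
  rw [slope_def_field]
  exact div_nonneg (by linarith) (by simpa using (le_of_lt hx0))

/-- The analytic condition expressing convexity of the omitted set. -/
theorem OmitsConvex.re_nonneg {Φ : ℂ → ℂ} {K : Set ℂ} (h : OmitsConvex Φ K) {v : ℂ}
    (hv : v ∈ ball (0 : ℂ) 1) (hv0 : v ≠ 0) {F : ℂ → ℂ} (hFdef : F = fun v => Φ v / v) :
    0 ≤ (-(1 + v * deriv (deriv F) v / deriv F v)).re := by
  have hFa : AnalyticAt ℂ F v := hFdef ▸ h.analytic_div v ⟨hv, hv0⟩
  have hinj := h.injOn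
  rw [← hFdef] at hinj
  have hF' : deriv F v ≠ 0 :=
    deriv_ne_zero_of_injOn (isOpen_punctured.mem_nhds ⟨hv, hv0⟩) hFa hinj
  obtain ⟨hopen, g, hg, hgi⟩ := exists_analytic_inverse isOpen_punctured
    (hFdef ▸ h.analytic_div) hinj
  set N : ℂ → ℂ := fun t => (F (exp (I * t) * v) + F (exp (I * -t) * v)) / 2 with hN
  have hN0 : N 0 = F v := by simp [hN]
  have hrot : AnalyticAt ℂ (fun t : ℂ => F (exp (I * t) * v)) 0 := by
    have h1 : AnalyticAt ℂ (fun t : ℂ => exp (I * t) * v) 0 := by fun_prop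
    refine AnalyticAt.fun_comp (g := F) ?_ h1
    simpa using hFa
  have hlim : Tendsto (fun t : ℂ => (N t - N 0) / t ^ 2) (𝓝[≠] 0)
      (𝓝 (-(v * deriv F v + v ^ 2 * deriv (deriv F) v) / 2)) := by
    have := tendsto_symmetric_difference hrot
    rw [deriv_deriv_comp_rotation hFa] at this
    simpa [hN] using this
  set A := -(v * deriv F v + v ^ 2 * deriv (deriv F) v) / 2 with hA
  have hsqrt : Tendsto (fun τ : ℝ => ((√τ : ℝ) : ℂ)) (𝓝[>] 0) (𝓝[≠] 0) := by
    refine tendsto_nhdsWithin_iff.2 ⟨?_, ?_⟩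
    · have : Continuous fun τ : ℝ => ((√τ : ℝ) : ℂ) := by fun_prop
      simpa using (this.tendsto 0).mono_left nhdsWithin_le_nhds
    · filter_upwards [self_mem_nhdsWithin] with τ hτ
      have : 0 < √τ := Real.sqrt_pos.2 hτ
      simpa using this.ne'
  -- `N` is even in the angle t, so with τ = t² its second-order term becomes a one-sided first
  -- derivative at τ = 0.
  have hS : HasDerivWithinAt (fun τ : ℝ => N (√τ : ℝ)) A (Ici 0) 0 := by
    refine HasDerivWithinAt.Ici_of_Ioi ?_
    rw [hasDerivWithinAt_iff_tendsto_slope' (by simp)]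
    refine (hlim.comp hsqrt).congr' ?_
    filter_upwards [self_mem_nhdsWithin] with τ hτ
    have h1 : ((√τ : ℝ) : ℂ) ^ 2 = (τ : ℂ) := by
      rw [← ofReal_pow, Real.sq_sqrt (le_of_lt hτ)]
    simp only [Function.comp, slope, h1, vsub_eq_sub, sub_zero, Real.sqrt_zero, ofReal_zero,
      real_smul, ofReal_inv]
    rw [div_eq_inv_mul]
  have hgF := hg _ (mem_image_of_mem F ⟨hv, hv0⟩)
  have hgv : g (F v) = v := hgi v ⟨hv, hv0⟩
  have hgd : HasDerivAt g (deriv F v)⁻¹ (F v) := by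
    have h1 := hgF.differentiableAt.hasDerivAt
    have h2 := h1.comp v hFa.differentiableAt.hasDerivAt
    have h3 : HasDerivAt (g ∘ F) 1 v := (hasDerivAt_id v).congr_of_eventuallyEq (by
      filter_upwards [isOpen_punctured.mem_nhds ⟨hv, hv0⟩] with x hx using hgi x hx)
    have h4 := h2.unique h3
    rwa [eq_inv_of_mul_eq_one_left h4] at h1
  have hcomp : HasDerivWithinAt (fun τ : ℝ => g (N (√τ : ℝ))) ((deriv F v)⁻¹ * A) (Ici 0) 0 := by
    have := HasDerivAt.comp_hasDerivWithinAt (h₂ := g) (h₂' := (deriv F v)⁻¹) (0 : ℝ)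
      (by simpa [hN0] using hgd) hS
    exact this
  -- By subordination |F⁻¹(N)|² is smallest at τ = 0, where F⁻¹(N) = v; its right derivative there
  -- is therefore nonnegative.
  have hnorm := deriv_nonneg_of_forall_ge hcomp.norm_sq ?_
  · simp only [Real.sqrt_zero, ofReal_zero, hN0, hgv] at hnorm
    have h1 : inner ℝ v ((deriv F v)⁻¹ * A) =
        ‖v‖ ^ 2 / 2 * (-(1 + v * deriv (deriv F) v / deriv F v)).re := by
      have h2 : (deriv F v)⁻¹ * A = v * (-(1 + v * deriv (deriv F) v / deriv F v) / 2) := by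
        rw [hA]
        field_simp
      rw [Complex.inner, h2, mul_right_comm, mul_conj, normSq_eq_norm_sq,
        Complex.re_ofReal_mul, show (2 : ℂ) = ((2 : ℝ) : ℂ) by norm_num, Complex.div_ofReal_re]
      ring
    rw [h1] at hnorm
    have h3 : 0 < ‖v‖ ^ 2 := by positivity
    by_contra! h4
    nlinarith
  · have hNc : Tendsto (fun τ : ℝ => N (√τ : ℝ)) (𝓝[>] 0) (𝓝 (F v)) := by
      have := (hS.Ioi_of_Ici).continuousWithinAt.tendsto
      simpa [hN0] using this
    have hcos : Tendsto (fun τ : ℝ => exp (I * (√τ : ℝ)) + exp (I * -(√τ : ℝ))) (𝓝[>] 0)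
        (𝓝 (1 + 1)) := by
      have : Continuous fun τ : ℝ => exp (I * (√τ : ℝ)) + exp (I * -(√τ : ℝ)) := by fun_prop
      simpa using (this.tendsto 0).mono_left nhdsWithin_le_nhds
    filter_upwards [hNc.eventually (hopen.mem_nhds (mem_image_of_mem F ⟨hv, hv0⟩)),
      hcos.eventually_ne (by norm_num : (1 + 1 : ℂ) ≠ 0)] with τ hτ hτ2
    obtain ⟨w, hw, hwN⟩ := hτ
    simp only [Real.sqrt_zero, ofReal_zero, hN0, hgv]
    rw [← hwN, hgi w hw]
    gcongr
    refine h.norm_le_of_mean_eq (a := exp (I * (√τ : ℝ))) (b := exp (I * -(√τ : ℝ)))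
      ?_ ?_ hτ2 hv hv0 hw.1 hw.2 ?_
    · rw [mul_comm]; exact norm_exp_ofReal_mul_I _
    · rw [mul_comm, ← ofReal_neg]; exact norm_exp_ofReal_mul_I _
    · rw [hFdef] at hwN
      simp only [hN, hFdef] at hwN
      exact hwN.symm

/-! ### The estimate near the origin -/

/-- A Borel–Carathéodory form of the Schwarz–Pick inequality. -/
theorem norm_sub_le_of_norm_le_one {f : ℂ → ℂ} (hf : DifferentiableOn ℂ f (ball 0 1))
    (hb : ∀ z ∈ ball (0 : ℂ) 1, ‖f z‖ ≤ 1) {z : ℂ} (hz : z ∈ ball (0 : ℂ) 1) :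
    ‖f z - f 0‖ ≤ 2 * (1 - ‖f 0‖) * ‖z‖ / (1 - ‖z‖) := by
  obtain ⟨u, hu, hu0⟩ : ∃ u : ℂ, ‖u‖ = 1 ∧ u * f 0 = ‖f 0‖ := by
    rcases eq_or_ne (f 0) 0 with h0 | h0
    · exact ⟨1, by simp, by simp [h0]⟩
    · have : (‖f 0‖ : ℂ) ≠ 0 := by simpa using h0
      refine ⟨‖f 0‖ / f 0, ?_, div_mul_cancel₀ _ h0⟩
      rw [norm_div, norm_real, norm_norm, div_self (norm_ne_zero_iff.2 h0)]
  have h0 := hb 0 (by simp)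
  have hz1 : 0 < 1 - ‖z‖ := by linarith [mem_ball_zero_iff.1 hz]
  -- The margin ε keeps the bound on the real part strictly positive when |f(0)| = 1.
  have key : ∀ ε > 0, ‖f z - f 0‖ ≤ 2 * (1 - ‖f 0‖ + ε) * ‖z‖ / (1 - ‖z‖) := by
    intro ε hε
    have := borelCaratheodory_zero (f := fun z => u * (f z - f 0)) (M := 1 - ‖f 0‖ + ε) (R := 1)
      (by linarith) (by fun_prop) (fun x hx => ?_) one_pos hz (by simp)
    · simpa [hu] using this
    · have h1 : (u * f x).re ≤ 1 := (re_le_norm _).trans (by rw [norm_mul, hu, one_mul]; exact hb x hx)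
      have h2 : (u * (f x - f 0)).re = (u * f x).re - ‖f 0‖ := by
        rw [mul_sub, hu0, sub_re, ofReal_re]
      change (u * (f x - f 0)).re ≤ _
      linarith
  have hcont : Tendsto (fun ε : ℝ => 2 * (1 - ‖f 0‖ + ε) * ‖z‖ / (1 - ‖z‖)) (𝓝[>] 0)
      (𝓝 (2 * (1 - ‖f 0‖ + 0) * ‖z‖ / (1 - ‖z‖))) := by
    have : Continuous fun ε : ℝ => 2 * (1 - ‖f 0‖ + ε) * ‖z‖ / (1 - ‖z‖) := by fun_prop
    exact (this.tendsto 0).mono_left nhdsWithin_le_nhds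
  rw [add_zero] at hcont
  exact ge_of_tendsto hcont (by filter_upwards [self_mem_nhdsWithin] with ε hε using key ε hε)

/-- If `z² f(z)` is bounded by one on the unit disc then so is `f`. -/
theorem norm_le_one_of_norm_sq_mul_le_one {f : ℂ → ℂ} (hf : DifferentiableOn ℂ f (ball 0 1))
    (hb : ∀ z ∈ ball (0 : ℂ) 1, ‖z ^ 2 * f z‖ ≤ 1) {z : ℂ} (hz : z ∈ ball (0 : ℂ) 1) :
    ‖f z‖ ≤ 1 := by
  have hz1 := mem_ball_zero_iff.1 hz
  have key : ∀ r ∈ Ioo ‖z‖ 1, ‖f z‖ ≤ 1 / r ^ 2 := by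
    intro r hr
    have hr0 : 0 < r := (norm_nonneg z).trans_lt hr.1
    refine Complex.norm_le_of_forall_mem_frontier_norm_le (U := ball (0 : ℂ) r) isBounded_ball
      ?_ ?_ (subset_closure (by simpa using hr.1))
    · exact hf.diffContOnCl_ball (closedBall_subset_ball hr.2)
    · intro x hx
      rw [frontier_ball _ hr0.ne', mem_sphere_zero_iff_norm] at hx
      have := hb x (by rw [mem_ball_zero_iff, hx]; exact hr.2)
      rw [norm_mul, norm_pow, hx] at this
      rw [le_div_iff₀ (by positivity)]
      linarith
  have hlim : Tendsto (fun r : ℝ => 1 / r ^ 2) (𝓝[<] 1) (𝓝 (1 / 1 ^ 2)) := by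
    have : ContinuousAt (fun r : ℝ => 1 / r ^ 2) 1 := by
      exact continuousAt_const.div (by fun_prop) (by norm_num)
    exact this.tendsto.mono_left nhdsWithin_le_nhds
  have := ge_of_tendsto hlim (by filter_upwards [Ioo_mem_nhdsLT hz1] with r hr using key r hr)
  simpa using this

section Estimate

variable {G : ℂ → ℂ}

/-- For `k = 1 - v² G` with `Re (1 - v k' / k) ≥ 0` on the unit disc, `k` satisfies the
differential equation `(1 - v² ω) k' = -2 v ω k` with a function `ω` bounded by one. -/
theorem exists_schwarz_function (hG : AnalyticOnNhd ℂ G (ball 0 1))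
    (hk0 : ∀ v ∈ ball (0 : ℂ) 1, 1 - v ^ 2 * G v ≠ 0)
    (hre : ∀ v ∈ ball (0 : ℂ) 1,
      0 ≤ (1 + v ^ 2 * (2 * G v + v * deriv G v) / (1 - v ^ 2 * G v)).re) :
    ∃ ω : ℂ → ℂ, DifferentiableOn ℂ ω (ball 0 1) ∧ ω 0 = G 0 ∧
      (∀ v ∈ ball (0 : ℂ) 1, ‖ω v‖ ≤ 1) ∧
      ∀ v ∈ ball (0 : ℂ) 1,
        (1 - v ^ 2 * ω v) * (2 * G v + v * deriv G v) = 2 * ω v * (1 - v ^ 2 * G v) := by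
  -- With q = -v k'/k, Re(1 + q) ≥ 0 gives |q| ≤ |q + 2|, and v² ω = q/(q + 2). The two expressions
  -- here are q k and (q + 2) k.
  have hden : ∀ v ∈ ball (0 : ℂ) 1, 2 + v ^ 3 * deriv G v ≠ 0 ∧
      ‖v ^ 2 * (2 * G v + v * deriv G v)‖ ≤ ‖2 + v ^ 3 * deriv G v‖ := by
    intro v hv
    have hk := hk0 v hv
    have hr := hre v hv
    set q := v ^ 2 * (2 * G v + v * deriv G v) / (1 - v ^ 2 * G v) with hq
    have h1 : v ^ 2 * (2 * G v + v * deriv G v) = q * (1 - v ^ 2 * G v) := by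
      rw [hq, div_mul_cancel₀ _ hk]
    have h2 : 2 + v ^ 3 * deriv G v = (q + 2) * (1 - v ^ 2 * G v) := by
      linear_combination h1
    rw [add_re, one_re] at hr
    constructor
    · rw [h2]
      refine mul_ne_zero (fun h3 => ?_) hk
      have := congrArg re h3
      simp at this
      linarith
    · rw [h1, h2, norm_mul, norm_mul]
      gcongr
      rw [← sq_le_sq₀ (norm_nonneg _) (norm_nonneg _), ← normSq_eq_norm_sq, ← normSq_eq_norm_sq,
        normSq_apply, normSq_apply]
      simp
      nlinarith
  have hGd : ∀ v ∈ ball (0 : ℂ) 1, DifferentiableAt ℂ G v ∧ DifferentiableAt ℂ (deriv G) v :=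
    fun v hv => ⟨(hG v hv).differentiableAt, (hG v hv).deriv.differentiableAt⟩
  have hωd : DifferentiableOn ℂ
      (fun v => (2 * G v + v * deriv G v) / (2 + v ^ 3 * deriv G v)) (ball 0 1) := by
    intro v hv
    obtain ⟨h1, h2⟩ := hGd v hv
    exact DifferentiableAt.differentiableWithinAt
      (DifferentiableAt.div (by fun_prop) (by fun_prop) (hden v hv).1)
  refine ⟨_, hωd, by simp, fun v hv => ?_, fun v hv => ?_⟩
  · refine norm_le_one_of_norm_sq_mul_le_one hωd (fun z hz => ?_) hv
    obtain ⟨h1, h2⟩ := hden z hz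
    rw [← mul_div_assoc, norm_div]
    exact (div_le_one (norm_pos_iff.2 h1)).2 h2
  · have := (hden v hv).1
    field_simp
    ring

/-- Near the origin `k = 1 - v² G` is close to `1 - c v²`, `c = G 0`, in terms of `1 - |c|`. -/
theorem norm_sq_mul_sub_le (hG : AnalyticOnNhd ℂ G (ball 0 1))
    (hk0 : ∀ v ∈ ball (0 : ℂ) 1, 1 - v ^ 2 * G v ≠ 0)
    (hre : ∀ v ∈ ball (0 : ℂ) 1,
      0 ≤ (1 + v ^ 2 * (2 * G v + v * deriv G v) / (1 - v ^ 2 * G v)).re) :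
    ‖G 0‖ ≤ 1 ∧ ∀ v : ℂ, ‖v‖ ≤ 3 / 10 → ‖v ^ 2 * (G 0 - G v)‖ ≤ (1 - ‖G 0‖) / 2 := by
  obtain ⟨ω, hωd, hω0, hω1, hode⟩ := exists_schwarz_function hG hk0 hre
  have hc1 : ‖G 0‖ ≤ 1 := hω0 ▸ hω1 0 (by simp)
  refine ⟨hc1, ?_⟩
  set c := G 0 with hc
  set s := closedBall (0 : ℂ) (3 / 10) with hs
  have hsD : s ⊆ ball (0 : ℂ) 1 := closedBall_subset_ball (by norm_num)
  set E : ℂ → ℂ := fun v => v ^ 2 * (c - G v) with hE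
  have hEd : ∀ v ∈ s, HasDerivAt E (2 * v * (c - G v) - v ^ 2 * deriv G v) v := by
    intro v hv
    have h1 := (hG v (hsD hv)).differentiableAt.hasDerivAt
    have := (hasDerivAt_pow 2 v).fun_mul (h1.const_sub c)
    refine this.congr_deriv ?_
    simp only [Nat.cast_ofNat]
    ring
  obtain ⟨v₀, hv₀, hmax⟩ := (isCompact_closedBall (0 : ℂ) (3 / 10)).exists_isMaxOn
    ⟨0, mem_closedBall_self (by norm_num)⟩ (f := fun v => ‖E v‖)
    (fun v hv => (hEd v hv).continuousAt.norm.continuousWithinAt)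
  set m := ‖E v₀‖ with hm
  have hmle : ∀ v ∈ s, ‖E v‖ ≤ m := fun v hv => hmax hv
  have hm0 : 0 ≤ m := norm_nonneg _
  -- For |v| ≤ 3/10: 3/5 bounds 2|v|, 6/7 = 2(3/10)/(1 - 3/10) comes from Schwarz–Pick for ω, and
  -- 91/100 = 1 - (3/10)².
  have hbound : ∀ v ∈ s, ‖2 * v * (c - G v) - v ^ 2 * deriv G v‖ ≤
      (3 / 5 * (6 / 7 * (1 - ‖c‖)) + 3 / 5 * m) / (91 / 100) := by
    intro v hv
    have hv' : ‖v‖ ≤ 3 / 10 := by simpa [hs] using hv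
    have hv0 := norm_nonneg v
    have hω := hω1 v (hsD hv)
    have hpick := norm_sub_le_of_norm_le_one hωd hω1 (hsD hv)
    rw [hω0] at hpick
    have hδ : ‖c - ω v‖ ≤ 6 / 7 * (1 - ‖c‖) := by
      rw [norm_sub_rev]
      refine hpick.trans ?_
      rw [div_le_iff₀ (by linarith)]
      nlinarith [mul_nonneg (sub_nonneg.2 hc1) (sub_nonneg.2 hv')]
    -- The equation for g rewritten for `E`, whose derivative is the second factor on the left: a
    -- linear equation with forcing term c - ω.
    have hode' : (1 - v ^ 2 * ω v) * (2 * v * (c - G v) - v ^ 2 * deriv G v) =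
        2 * v * (c - ω v) - 2 * v * ω v * E v := by
      simp only [hE]
      linear_combination -v * hode v (hsD hv)
    have hlow : 91 / 100 ≤ ‖1 - v ^ 2 * ω v‖ := by
      have h1 : ‖v ^ 2 * ω v‖ ≤ 9 / 100 := by
        rw [norm_mul, norm_pow]
        calc ‖v‖ ^ 2 * ‖ω v‖ ≤ (3 / 10) ^ 2 * 1 := by gcongr
          _ = 9 / 100 := by norm_num
      have h2 := norm_sub_norm_le 1 (v ^ 2 * ω v)
      rw [norm_one] at h2
      linarith
    have hup : ‖2 * v * (c - ω v) - 2 * v * ω v * E v‖ ≤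
        3 / 5 * (6 / 7 * (1 - ‖c‖)) + 3 / 5 * m := by
      refine (norm_sub_le _ _).trans ?_
      simp only [norm_mul, Complex.norm_ofNat]
      have h1 : 2 * ‖v‖ * ‖c - ω v‖ ≤ 3 / 5 * (6 / 7 * (1 - ‖c‖)) := by
        gcongr
        linarith
      have h2 : 2 * ‖v‖ * ‖ω v‖ * ‖E v‖ ≤ 3 / 5 * m := by
        have : 2 * ‖v‖ * ‖ω v‖ ≤ 3 / 5 := by nlinarith
        exact mul_le_mul this (hmle v hv) (norm_nonneg _) (by norm_num)
      linarith
    rw [← hode', norm_mul] at hup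
    rw [le_div_iff₀ (by norm_num)]
    refine le_trans ?_ hup
    rw [mul_comm]
    gcongr
  have hmv := (convex_closedBall (0 : ℂ) (3 / 10)).norm_image_sub_le_of_norm_hasDerivWithin_le
    (fun v hv => (hEd v hv).hasDerivWithinAt) hbound (mem_closedBall_self (by norm_num)) hv₀
  have hE0 : E 0 = 0 := by simp [hE]
  rw [hE0, sub_zero, sub_zero] at hmv
  have hv₀' : ‖v₀‖ ≤ 3 / 10 := by simpa using hv₀
  -- The mean value inequality from E(0) = 0 bounds m by a multiple of 1 - |c| plus about 0.2·m, and
  -- the latter is absorbed on the left.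
  have hmfin : m ≤ (1 - ‖c‖) / 2 := by
    have h1 : m ≤ (3 / 5 * (6 / 7 * (1 - ‖c‖)) + 3 / 5 * m) / (91 / 100) * (3 / 10) := by
      refine hmv.trans ?_
      gcongr
    linarith
  intro v hv
  exact (hmle v (by simpa [hs] using hv)).trans hmfin

/-- The right side of `norm_sq_mul_sub_le` vanishes, so `G` is constant near 0; the identity theorem
does the rest. -/
theorem eq_const_of_norm_eq_one (hG : AnalyticOnNhd ℂ G (ball 0 1))
    (hk0 : ∀ v ∈ ball (0 : ℂ) 1, 1 - v ^ 2 * G v ≠ 0)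
    (hre : ∀ v ∈ ball (0 : ℂ) 1,
      0 ≤ (1 + v ^ 2 * (2 * G v + v * deriv G v) / (1 - v ^ 2 * G v)).re)
    (h1 : ‖G 0‖ = 1) : ∀ v ∈ ball (0 : ℂ) 1, G v = G 0 := by
  have hle := (norm_sq_mul_sub_le hG hk0 hre).2
  have hev : G =ᶠ[𝓝 0] fun _ => G 0 := by
    filter_upwards [closedBall_mem_nhds (0 : ℂ) (by norm_num : (0 : ℝ) < 3 / 10)] with v hv
    rcases eq_or_ne v 0 with rfl | hv0
    · rfl
    have := hle v (by simpa using hv)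
    rw [h1, sub_self, zero_div, norm_le_zero_iff, mul_eq_zero] at this
    rcases this with h | h
    · exact absurd h (pow_ne_zero _ hv0)
    · exact (sub_eq_zero.1 h).symm
  exact fun v hv => hG.eqOn_of_preconnected_of_eventuallyEq (fun _ _ => analyticAt_const)
    (convex_ball _ _).isPreconnected (mem_ball_self one_pos) hev hv

end Estimate

/-! ### The disc automorphism moving the pole to the origin -/

/-- The automorphism `z ↦ (z - p) / (1 - p z)` of the unit disc. -/
noncomputable def discAut (p : ℝ) (z : ℂ) : ℂ := (z - p) / (1 - p * z)

section DiscAut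

variable {p : ℝ} {z : ℂ}

theorem one_sub_mul_ne_zero (hp : |p| < 1) (hz : z ∈ ball (0 : ℂ) 1) : 1 - (p : ℂ) * z ≠ 0 := by
  intro h
  have h1 : ‖(p : ℂ) * z‖ < 1 := by
    rw [norm_mul, norm_real, Real.norm_eq_abs]
    have := mem_ball_zero_iff.1 hz
    nlinarith [abs_nonneg p, norm_nonneg z]
  rw [← sub_eq_zero.1 h] at h1
  simp at h1

theorem normSq_one_sub_sub_normSq (p : ℝ) (z : ℂ) :
    ‖1 - (p : ℂ) * z‖ ^ 2 - ‖z - p‖ ^ 2 = (1 - p ^ 2) * (1 - ‖z‖ ^ 2) := by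
  rw [← normSq_eq_norm_sq, ← normSq_eq_norm_sq, ← normSq_eq_norm_sq, normSq_apply, normSq_apply,
    normSq_apply]
  simp
  ring

theorem discAut_mem_ball (hp : |p| < 1) (hz : z ∈ ball (0 : ℂ) 1) :
    discAut p z ∈ ball (0 : ℂ) 1 := by
  have h0 := one_sub_mul_ne_zero hp hz
  rw [mem_ball_zero_iff] at hz ⊢
  rw [discAut, norm_div, div_lt_one (norm_pos_iff.2 h0), ← sq_lt_sq₀ (norm_nonneg _) (norm_nonneg _)]
  have h1 := normSq_one_sub_sub_normSq p z
  have h2 : 0 < 1 - p ^ 2 := by rw [sub_pos, sq_lt_one_iff_abs_lt_one]; exact hp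
  have h3 : 0 < 1 - ‖z‖ ^ 2 := by nlinarith [norm_nonneg z]
  nlinarith [mul_pos h2 h3]

theorem ofReal_one_sub_sq_ne_zero (hp : |p| < 1) : (1 : ℂ) - (p : ℂ) ^ 2 ≠ 0 := by
  have h2 : 0 < 1 - p ^ 2 := by rw [sub_pos, sq_lt_one_iff_abs_lt_one]; exact hp
  exact_mod_cast h2.ne'

theorem discAut_neg_discAut (hp : |p| < 1) (hz : z ∈ ball (0 : ℂ) 1) :
    discAut (-p) (discAut p z) = z := by
  have h0 := one_sub_mul_ne_zero hp hz
  have h1 := ofReal_one_sub_sq_ne_zero hp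
  have h2 : 1 - ((-p : ℝ) : ℂ) * discAut p z = (1 - (p : ℂ) ^ 2) / (1 - p * z) := by
    rw [discAut]
    push_cast
    field_simp
    ring
  rw [discAut, h2, discAut, div_div_eq_mul_div, div_eq_iff h1, sub_mul, div_mul_cancel₀ _ h0]
  push_cast
  ring

theorem discAut_discAut_neg (hp : |p| < 1) (hz : z ∈ ball (0 : ℂ) 1) :
    discAut p (discAut (-p) z) = z := by
  have := discAut_neg_discAut (p := -p) (by rwa [abs_neg]) hz
  rwa [neg_neg] at this

theorem hasDerivAt_discAut (hp : |p| < 1) (hz : z ∈ ball (0 : ℂ) 1) :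
    HasDerivAt (discAut p) ((1 - (p : ℂ) ^ 2) / (1 - p * z) ^ 2) z := by
  have h0 := one_sub_mul_ne_zero hp hz
  have h1 : HasDerivAt (fun z : ℂ => 1 - (p : ℂ) * z) (-p) z := by
    simpa using ((hasDerivAt_id z).const_mul (p : ℂ)).const_sub 1
  refine (((hasDerivAt_id z).sub_const (p : ℂ)).div h1 h0).congr_deriv ?_
  simp only [id]
  ring

theorem analyticAt_discAut (hp : |p| < 1) (hz : z ∈ ball (0 : ℂ) 1) :
    AnalyticAt ℂ (discAut p) z :=
  (analyticAt_id.sub analyticAt_const).div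
    (analyticAt_const.sub (analyticAt_const.mul analyticAt_id)) (one_sub_mul_ne_zero hp hz)

@[simp] theorem discAut_self (p : ℝ) : discAut p p = 0 := by simp [discAut]

@[simp] theorem discAut_zero (p : ℝ) : discAut p 0 = -p := by simp [discAut]

theorem discAut_ne_zero (hp : |p| < 1) (hz : z ∈ ball (0 : ℂ) 1) (hzp : z ≠ p) :
    discAut p z ≠ 0 :=
  div_ne_zero (sub_ne_zero.2 hzp) (one_sub_mul_ne_zero hp hz)

theorem ofReal_mem_ball (hp : |p| < 1) : (p : ℂ) ∈ ball (0 : ℂ) 1 := by simpa using hp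

end DiscAut

/-! ### Laurent coefficients at the pole -/

section Laurent

variable {p : ℝ} {f H : ℂ → ℂ}

theorem ball_subset_unit_ball (hp0 : 0 < p) : ball (p : ℂ) (1 - p) ⊆ ball (0 : ℂ) 1 := by
  refine ball_subset_ball' ?_
  simp [abs_of_pos hp0]

/-- The simple pole shifts indices by one: a_{k-1}(f) is the k-th Taylor coefficient of H = (z - p)
f at p. -/
theorem laurentCoeff_eq (hp0 : 0 < p) (hp1 : p < 1) (hH : AnalyticOnNhd ℂ H (ball 0 1))
    (hf : ∀ z ∈ ball (0 : ℂ) 1, z ≠ p → f z = H z / (z - p)) (k : ℕ) :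
    laurentCoeff p ((k : ℤ) - 1) f = iteratedDeriv k H p / (k.factorial : ℂ) := by
  have hr : 0 < (1 - p) / 2 := by linarith
  have hcl : closedBall (p : ℂ) ((1 - p) / 2) ⊆ ball (0 : ℂ) 1 :=
    (closedBall_subset_ball (by linarith)).trans (ball_subset_unit_ball hp0)
  have hcauchy := DifferentiableOn.circleIntegral_one_div_sub_center_pow_smul hr k
    (f := H) (c := (p : ℂ)) fun z hz => (hH z (hcl hz)).differentiableAt.differentiableWithinAt
  have hint : (∮ z in C((p : ℂ), (1 - p) / 2), f z / (z - (p : ℂ)) ^ ((k : ℤ) - 1 + 1)) =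
      ∮ z in C((p : ℂ), (1 - p) / 2), (1 / (z - (p : ℂ)) ^ (k + 1)) • H z := by
    refine circleIntegral.integral_congr hr.le fun z hz => ?_
    have hzp : z ≠ p := ne_of_mem_sphere hz hr.ne'
    have hzp' := sub_ne_zero.2 hzp
    rw [hf z (hcl (sphere_subset_closedBall hz)) hzp, sub_add_cancel, zpow_natCast, smul_eq_mul]
    field_simp
    ring
  rw [laurentCoeff, hint, hcauchy, smul_eq_mul, ← mul_assoc, ← mul_div_assoc,
    inv_mul_cancel₀ two_pi_I_ne_zero]
  ring

theorem hasSum_laurent (hp0 : 0 < p) (hp1 : p < 1) (hH : AnalyticOnNhd ℂ H (ball 0 1))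
    (hf : ∀ z ∈ ball (0 : ℂ) 1, z ≠ p → f z = H z / (z - p)) {z : ℂ} (hz0 : 0 < ‖z - p‖)
    (hz1 : ‖z - p‖ < 1 - p) :
    HasSum (fun k : ℕ => laurentCoeff p ((k : ℤ) - 1) f * (z - (p : ℂ)) ^ ((k : ℤ) - 1)) (f z) := by
  have hzb : z ∈ ball (p : ℂ) (1 - p) := by rwa [mem_ball, dist_eq]
  have hzp : z - p ≠ 0 := norm_pos_iff.1 hz0
  have hs := hasSum_taylorSeries_on_ball (f := H) (c := (p : ℂ)) (r := 1 - p)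
    (fun z hz => (hH z (ball_subset_unit_ball hp0 hz)).differentiableAt.differentiableWithinAt) hzb
  rw [hf z (ball_subset_unit_ball hp0 hzb) (sub_ne_zero.1 hzp)]
  refine (hs.div_const (z - p)).congr_fun fun k => ?_
  rw [laurentCoeff_eq hp0 hp1 hH hf, zpow_sub_one₀ hzp, zpow_natCast]
  simp only [smul_eq_mul]
  ring

/-- The first Laurent coefficient in terms of an expansion in the coordinate `discAut p`. -/
theorem laurentCoeff_one_eq (hp0 : 0 < p) (hp1 : p < 1) {b : ℂ} {G : ℂ → ℂ}
    (hG : AnalyticOnNhd ℂ G (ball 0 1))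
    (hf : ∀ z ∈ ball (0 : ℂ) 1, z ≠ p → f z = b / discAut p z + G (discAut p z)) :
    laurentCoeff p 1 f = deriv G 0 / (1 - (p : ℂ) ^ 2) := by
  have hp : |p| < 1 := by rwa [abs_of_pos hp0]
  have hGc : ∀ z ∈ ball (0 : ℂ) 1, AnalyticAt ℂ (fun z => G (discAut p z)) z := fun z hz =>
    (hG _ (discAut_mem_ball hp hz)).fun_comp (analyticAt_discAut hp hz)
  set H : ℂ → ℂ := fun z => b * (1 - p * z) + (z - p) * G (discAut p z) with hHdef
  have hH : AnalyticOnNhd ℂ H (ball 0 1) := fun z hz =>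
    AnalyticAt.add (by fun_prop) (AnalyticAt.mul (by fun_prop) (hGc z hz))
  have hfH : ∀ z ∈ ball (0 : ℂ) 1, z ≠ p → f z = H z / (z - p) := by
    intro z hz hzp
    have h1 := one_sub_mul_ne_zero hp hz
    have h2 := sub_ne_zero.2 hzp
    rw [hf z hz hzp, hHdef]
    simp only
    rw [add_div, mul_div_cancel_left₀ _ h2, discAut, div_div_eq_mul_div]
  have hcoef := laurentCoeff_eq hp0 hp1 hH hfH 2
  norm_num at hcoef
  have hpb := ofReal_mem_ball hp
  have hd : ∀ z ∈ ball (0 : ℂ) 1, deriv H z =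
      -b * p + (G (discAut p z) + (z - p) * deriv (fun z => G (discAut p z)) z) := by
    intro z hz
    have h1 : HasDerivAt (fun z : ℂ => b * (1 - (p : ℂ) * z)) (-b * p) z := by
      have := (((hasDerivAt_id z).const_mul (p : ℂ)).const_sub 1).const_mul b
      exact this.congr_deriv (by ring)
    have h2 := ((hasDerivAt_id z).sub_const (p : ℂ)).fun_mul
      (hGc z hz).differentiableAt.hasDerivAt
    exact ((h1.fun_add h2).congr_deriv (by simp)).deriv
  have hd2 : deriv (deriv H) p = 2 * deriv (fun z => G (discAut p z)) p := by
    have hev : deriv H =ᶠ[𝓝 (p : ℂ)] fun z =>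
        -b * p + (G (discAut p z) + (z - p) * deriv (fun z => G (discAut p z)) z) := by
      filter_upwards [isOpen_ball.mem_nhds hpb] with z hz using hd z hz
    rw [hev.deriv_eq]
    have h1 := (hGc p hpb).differentiableAt.hasDerivAt
    have h2 := ((hasDerivAt_id (p : ℂ)).sub_const (p : ℂ)).fun_mul
      (hGc p hpb).deriv.differentiableAt.hasDerivAt
    refine HasDerivAt.deriv (((h1.fun_add h2).const_add (-b * p)).congr_deriv ?_)
    simp only [id]
    ring
  have hd3 : deriv (fun z => G (discAut p z)) p = deriv G 0 / (1 - (p : ℂ) ^ 2) := by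
    have h1 : HasDerivAt G (deriv G 0) (discAut p p) := by
      rw [discAut_self]
      exact (hG 0 (by simp)).differentiableAt.hasDerivAt
    refine HasDerivAt.deriv ((h1.comp (p : ℂ) (hasDerivAt_discAut hp hpb)).congr_deriv ?_)
    have := ofReal_one_sub_sq_ne_zero hp
    rw [← sq]
    field_simp
  rw [hcoef, iteratedDeriv_succ, iteratedDeriv_one, hd2, hd3]
  ring

end Laurent

/-! ### Concave functions in the coordinate `discAut p` -/

namespace IsConcave

variable {p : ℝ} {f : ℂ → ℂ}

theorem order_nonneg (hf : IsConcave p f) (hp : |p| < 1) {z : ℂ} (hz : z ∈ ball (0 : ℂ) 1)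
    (hzp : z ≠ p) : ¬ meromorphicOrderAt f z < 0 := by
  intro h
  refine hzp (hf.injOn hz (ofReal_mem_ball hp) ?_)
  have hlt : meromorphicOrderAt f (p : ℂ) < 0 := by rw [hf.simple_pole]; decide
  simp [toSphere, h, hlt]

theorem toSphere_eq (hf : IsConcave p f) (hp : |p| < 1) {z : ℂ} (hz : z ∈ ball (0 : ℂ) 1)
    (hzp : z ≠ p) : toSphere f z = (f z : OnePoint ℂ) := by
  simp [toSphere, hf.order_nonneg hp hz hzp]

theorem toSphere_pole (hf : IsConcave p f) : toSphere f p = OnePoint.infty := by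
  have hlt : meromorphicOrderAt f (p : ℂ) < 0 := by rw [hf.simple_pole]; decide
  simp [toSphere, hlt]

theorem analyticAt (hf : IsConcave p f) (hp : |p| < 1) {z : ℂ} (hz : z ∈ ball (0 : ℂ) 1)
    (hzp : z ≠ p) : AnalyticAt ℂ f z :=
  (hf.meromorphic hz).meromorphicOrderAt_nonneg_iff_analyticAt.1
    (not_lt.1 (hf.order_nonneg hp hz hzp))

theorem exists_eq_div (hf : IsConcave p f) (hp : |p| < 1) :
    ∃ H : ℂ → ℂ, AnalyticOnNhd ℂ H (ball 0 1) ∧ H p ≠ 0 ∧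
      ∀ z ∈ ball (0 : ℂ) 1, z ≠ p → f z = H z / (z - p) := by
  have hpb := ofReal_mem_ball hp
  have hord : meromorphicOrderAt f (p : ℂ) = ((-1 : ℤ) : WithTop ℤ) := hf.simple_pole
  obtain ⟨g, hg, hg0, hgf⟩ :=
    (meromorphicOrderAt_eq_int_iff (hf.meromorphic hpb).meromorphicAt).1 hord
  have hne : ∀ z, z ≠ (p : ℂ) → Function.update (fun z => (z - p) * f z) p (g p) z = (z - p) * f z :=
    fun z hz => Function.update_of_ne hz _ _
  refine ⟨Function.update (fun z => (z - p) * f z) p (g p), fun z hz => ?_, by simpa using hg0,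
    fun z hz hzp => ?_⟩
  · rcases eq_or_ne z p with rfl | hzp
    · refine hg.congr ?_
      rw [eventually_nhdsWithin_iff] at hgf
      filter_upwards [hgf] with x hx
      rcases eq_or_ne x p with rfl | hxp
      · simp
      · rw [hne x hxp, hx hxp]
        have := sub_ne_zero.2 hxp
        simp [this]
    · refine (AnalyticAt.mul (by fun_prop : AnalyticAt ℂ (fun z : ℂ => z - p) z)
        (hf.analyticAt hp hz hzp)).congr ?_
      filter_upwards [isOpen_ne.mem_nhds hzp] with x hx
      exact (hne x hx).symm
  · rw [hne z hzp, mul_div_cancel_left₀ _ (sub_ne_zero.2 hzp)]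

theorem exists_expansion (hf : IsConcave p f) (hp : |p| < 1) :
    ∃ (b : ℂ) (G : ℂ → ℂ) (K : Set ℂ), AnalyticOnNhd ℂ G (ball 0 1) ∧
      OmitsConvex (fun v => b + v * G v) K ∧
      ∀ z ∈ ball (0 : ℂ) 1, z ≠ p → f z = b / discAut p z + G (discAut p z) := by
  obtain ⟨H, hH, hH0, hfH⟩ := hf.exists_eq_div hp
  obtain ⟨K, hK, hKf⟩ := hf.convex_compl
  have hs := ofReal_one_sub_sq_ne_zero hp
  have hp' : |-p| < 1 := by rwa [abs_neg]
  -- This is v·f(z) with z = `discAut (-p) v`, because z - p = v (1 - p²)/(1 + p v). The expansion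
  -- splits off Φ(0).
  set Φ : ℂ → ℂ := fun v => H (discAut (-p) v) * (1 + p * v) / (1 - (p : ℂ) ^ 2) with hΦ
  have hΦa : AnalyticOnNhd ℂ Φ (ball 0 1) := by
    intro v hv
    have h1 : AnalyticAt ℂ (fun v => H (discAut (-p) v)) v :=
      (hH _ (discAut_mem_ball hp' hv)).fun_comp (analyticAt_discAut hp' hv)
    exact (h1.mul (by fun_prop : AnalyticAt ℂ (fun v : ℂ => 1 + (p : ℂ) * v) v)).div
      analyticAt_const hs
  have hΦf : ∀ z ∈ ball (0 : ℂ) 1, z ≠ p → Φ (discAut p z) / discAut p z = f z := by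
    intro z hz hzp
    have h1 := one_sub_mul_ne_zero hp hz
    have h2 := sub_ne_zero.2 hzp
    simp only [hΦ]
    rw [discAut_neg_discAut hp hz, hfH z hz hzp, discAut]
    field_simp
    ring
  have hΦe : Φ = fun v => Φ 0 + v * dslope Φ 0 v := by
    funext v
    have := sub_smul_dslope Φ 0 v
    rw [sub_zero, smul_eq_mul] at this
    rw [this]
    ring
  have hGa : AnalyticOnNhd ℂ (dslope Φ 0) (ball 0 1) :=
    ((differentiableOn_dslope (ball_mem_nhds (0 : ℂ) one_pos)).2
      hΦa.differentiableOn).analyticOnNhd isOpen_ball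
  have hback : ∀ v ∈ ball (0 : ℂ) 1, v ≠ 0 → discAut (-p) v ∈ ball (0 : ℂ) 1 ∧
      discAut (-p) v ≠ p ∧ Φ v / v = f (discAut (-p) v) := by
    intro v hv hv0
    have h1 := discAut_mem_ball hp' hv
    have h2 := discAut_discAut_neg hp hv
    have h3 : discAut (-p) v ≠ p := by
      intro h
      rw [h, discAut_self] at h2
      exact hv0 h2.symm
    refine ⟨h1, h3, ?_⟩
    rw [← hΦf _ h1 h3, h2]
  refine ⟨Φ 0, dslope Φ 0, K, hGa, ?_, ?_⟩
  · rw [← hΦe]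
    refine ⟨hΦa, ?_, ?_, hK, ?_⟩
    · simpa [hΦ, discAut] using ⟨hH0, hs⟩
    · intro v hv w hw hvw
      obtain ⟨hv1, hv2, hv3⟩ := hback v hv.1 hv.2
      obtain ⟨hw1, hw2, hw3⟩ := hback w hw.1 hw.2
      simp only at hvw
      rw [hv3, hw3] at hvw
      have := hf.injOn hv1 hw1 (by
        rw [hf.toSphere_eq hp hv1 hv2, hf.toSphere_eq hp hw1 hw2, hvw])
      rw [← discAut_discAut_neg hp hv.1, ← discAut_discAut_neg hp hw.1, this]
    · ext y
      have hy : y ∈ K ↔ (y : OnePoint ℂ) ∉ toSphere f '' ball 0 1 := by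
        rw [← mem_compl_iff, hKf]
        exact ((OnePoint.coe_injective).mem_set_image).symm
      rw [mem_compl_iff, hy, not_not]
      constructor
      · rintro ⟨v, hv, rfl⟩
        obtain ⟨hv1, hv2, hv3⟩ := hback v hv.1 hv.2
        exact ⟨_, hv1, by rw [hf.toSphere_eq hp hv1 hv2, ← hv3]⟩
      · rintro ⟨z, hz, hzy⟩
        have hzp : z ≠ p := by
          rintro rfl
          rw [hf.toSphere_pole] at hzy
          exact OnePoint.infty_ne_coe _ hzy
        rw [hf.toSphere_eq hp hz hzp] at hzy
        refine ⟨discAut p z, ⟨discAut_mem_ball hp hz, discAut_ne_zero hp hz hzp⟩, ?_⟩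
        simp only
        rw [hΦf z hz hzp]
        exact OnePoint.coe_injective hzy
  · intro z hz hzp
    have h0 := discAut_ne_zero hp hz hzp
    rw [← hΦf z hz hzp]
    conv_lhs => rw [hΦe]
    field_simp

end IsConcave

/-- The conditions of the estimate `norm_sq_mul_sub_le` hold for `deriv G / b`. -/
theorem OmitsConvex.deriv_conditions {b : ℂ} {G : ℂ → ℂ} {K : Set ℂ}
    (hG : AnalyticOnNhd ℂ G (ball 0 1)) (h : OmitsConvex (fun v => b + v * G v) K) :
    (∀ v ∈ ball (0 : ℂ) 1, 1 - v ^ 2 * (deriv G v / b) ≠ 0) ∧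
    ∀ v ∈ ball (0 : ℂ) 1, 0 ≤ (1 + v ^ 2 * (2 * (deriv G v / b) + v * deriv (fun v => deriv G v / b) v)
      / (1 - v ^ 2 * (deriv G v / b))).re := by
  have hb : b ≠ 0 := by simpa using h.ne_zero
  set F : ℂ → ℂ := fun v => (b + v * G v) / v with hF
  have hd1 : ∀ v ∈ ball (0 : ℂ) 1 \ {0}, HasDerivAt F (-b / v ^ 2 + deriv G v) v := by
    intro v hv
    have hv0 : v ≠ 0 := hv.2
    have h1 : HasDerivAt (fun v => b * v⁻¹ + G v) (-b / v ^ 2 + deriv G v) v :=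
      (((hasDerivAt_inv hv0).const_mul b).fun_add
        (hG v hv.1).differentiableAt.hasDerivAt).congr_deriv (by ring)
    refine h1.congr_of_eventuallyEq ?_
    filter_upwards [isOpen_ne.mem_nhds hv0] with x hx
    have hx0 : x ≠ 0 := hx
    rw [hF]
    field_simp
  have hd2 : ∀ v ∈ ball (0 : ℂ) 1 \ {0},
      deriv (deriv F) v = 2 * b / v ^ 3 + deriv (deriv G) v := by
    intro v hv
    have hv0 : v ≠ 0 := hv.2
    have hev : deriv F =ᶠ[𝓝 v] fun v => -b * (v ^ 2)⁻¹ + deriv G v := by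
      filter_upwards [OmitsConvex.isOpen_punctured.mem_nhds hv] with x hx
      rw [(hd1 x hx).deriv, div_eq_mul_inv]
    rw [hev.deriv_eq]
    have h1 := (((hasDerivAt_pow 2 v).fun_inv (pow_ne_zero 2 hv0)).const_mul (-b)).fun_add
      (hG v hv.1).deriv.differentiableAt.hasDerivAt
    rw [h1.deriv]
    field_simp
    norm_num
    ring
  have hk : ∀ v ∈ ball (0 : ℂ) 1, 1 - v ^ 2 * (deriv G v / b) ≠ 0 := by
    intro v hv h0
    rcases eq_or_ne v 0 with rfl | hv0
    · simp at h0
    refine deriv_ne_zero_of_injOn (OmitsConvex.isOpen_punctured.mem_nhds ⟨hv, hv0⟩)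
      (h.analytic_div v ⟨hv, hv0⟩) h.injOn ?_
    rw [(hd1 v ⟨hv, hv0⟩).deriv]
    field_simp at h0 ⊢
    linear_combination -h0
  refine ⟨hk, fun v hv => ?_⟩
  rcases eq_or_ne v 0 with rfl | hv0
  · simp
  have hre := h.re_nonneg hv hv0 hF
  convert hre using 2
  have hkv := hk v hv
  rw [hd2 v ⟨hv, hv0⟩, (hd1 v ⟨hv, hv0⟩).deriv, deriv_div_const]
  -- F' = -(b/v²) k with k = 1 - v² G'/b, so univalence gives k ≠ 0 and -(1 + v F''/F') equals 1 - v
  -- k'/k.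
  have h1 : -b / v ^ 2 + deriv G v = -(b / v ^ 2) * (1 - v ^ 2 * (deriv G v / b)) := by
    field_simp
    ring
  have h2 : v * (2 * b / v ^ 3 + deriv (deriv G) v) =
      (b / v ^ 2) * (2 + v ^ 3 * (deriv (deriv G) v / b)) := by
    field_simp
  rw [h1, h2, neg_mul, div_neg, mul_div_mul_left _ _ (div_ne_zero hb (pow_ne_zero 2 hv0))]
  generalize deriv (deriv G) v / b = g'' at *
  generalize deriv G v / b = g' at *
  field_simp
  ring

/-- The first Laurent coefficient of a concave function in terms of the exterior parameters `c`
and `κ`, with the decisive estimate and its extremal case. -/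
theorem IsConcave.exists_parameters {p : ℝ} {f : ℂ → ℂ} (hf : IsConcave p f) (hp0 : 0 < p)
    (hp : p ≤ 3 / 10) :
    ∃ c κ : ℂ, κ ≠ 0 ∧ laurentCoeff p 1 f * ((1 - (p : ℂ) ^ 2) / p) ^ 2 = -c / κ ∧ ‖c‖ ≤ 1 ∧
      (1 + ‖c‖) / 2 ≤ ‖κ + c * p ^ 2‖ ∧
      (‖c‖ = 1 → ∃ d : ℂ, ∀ z ∈ ball (0 : ℂ) 1, z ≠ p →
        f z = -p ^ 2 / ((1 - (p : ℂ) ^ 2) * (1 - c * p ^ 2)) *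
          (1 / discAut p z + c * discAut p z) + d) := by
  have hpa : |p| < 1 := by rw [abs_of_pos hp0]; linarith
  have hpc : (p : ℂ) ≠ 0 := by exact_mod_cast hp0.ne'
  have hs := ofReal_one_sub_sq_ne_zero hpa
  obtain ⟨b, G, K, hG, hK, hfG⟩ := hf.exists_expansion hpa
  have hb : b ≠ 0 := by simpa using hK.ne_zero
  obtain ⟨hk, hre⟩ := hK.deriv_conditions hG
  have hga : AnalyticOnNhd ℂ (fun v => deriv G v / b) (ball 0 1) := fun v hv =>
    (hG v hv).deriv.div analyticAt_const hb
  obtain ⟨hc1, hest⟩ := norm_sq_mul_sub_le hga hk hre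
  have hmp : -(p : ℂ) ∈ ball (0 : ℂ) 1 := by simpa using hpa
  have hκ := hk _ hmp
  set κ := 1 - (-(p : ℂ)) ^ 2 * (deriv G (-p) / b) with hκdef
  set c := deriv G 0 / b with hc
  -- This is f'(0) = 1 by the chain rule, with `discAut p` sending 0 to -p with derivative 1 - p².
  have hbκ : b * κ * (1 - (p : ℂ) ^ 2) = -p ^ 2 := by
    have h0 : (0 : ℂ) ∈ ball (0 : ℂ) 1 := by simp
    have hT : HasDerivAt (discAut p) (1 - (p : ℂ) ^ 2) 0 := by
      simpa using hasDerivAt_discAut hpa h0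
    have hG' : HasDerivAt G (deriv G (-p)) (discAut p 0) := by
      rw [discAut_zero]
      exact (hG _ hmp).differentiableAt.hasDerivAt
    have hT0 : discAut p 0 ≠ 0 := by simpa using hpc
    have h1 := ((hT.fun_inv hT0).const_mul b).fun_add (hG'.comp (0 : ℂ) hT)
    have h2 : HasDerivAt f _ 0 := h1.congr_of_eventuallyEq (by
      filter_upwards [isOpen_ball.mem_nhds h0, isOpen_ne.mem_nhds (Ne.symm hpc)] with z hz hzp
      rw [hfG z hz hzp, div_eq_mul_inv]
      rfl)
    have h3 := h2.unique hf.deriv_zero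
    rw [discAut_zero] at h3
    rw [hκdef]
    field_simp at h3 ⊢
    linear_combination -h3
  refine ⟨c, κ, hκ, ?_, hc1, ?_, fun hc1 => ?_⟩
  · rw [laurentCoeff_one_eq hp0 (by linarith) hG hfG, show deriv G 0 = b * c by
      rw [hc, mul_div_cancel₀ _ hb]]
    field_simp
    linear_combination c * hbκ
  · have h1 := hest (-p) (by simpa [abs_of_pos hp0] using hp)
    have h2 : κ + c * p ^ 2 = 1 + (-(p : ℂ)) ^ 2 * (c - deriv G (-p) / b) := by
      rw [hκdef]
      ring
    have h3 := norm_sub_le_norm_add 1 ((-(p : ℂ)) ^ 2 * (c - deriv G (-p) / b))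
    rw [norm_one] at h3
    rw [h2]
    linarith
  · have hconst := eq_const_of_norm_eq_one hga hk hre hc1
    have hderiv : ∀ v ∈ ball (0 : ℂ) 1, deriv G v = b * c := by
      intro v hv
      rw [hc, ← hconst v hv, mul_div_cancel₀ _ hb]
    have hlin : ∀ v ∈ ball (0 : ℂ) 1, HasDerivAt (fun v => G v - b * c * v) 0 v := by
      intro v hv
      have h1 := (hG v hv).differentiableAt.hasDerivAt
      rw [hderiv v hv] at h1
      exact (h1.fun_sub ((hasDerivAt_id v).const_mul (b * c))).congr_deriv (by simp)
    obtain ⟨d, hd⟩ := isOpen_ball.exists_is_const_of_deriv_eq_zero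
      (convex_ball (0 : ℂ) 1).isPreconnected
      (fun v hv => (hlin v hv).differentiableAt.differentiableWithinAt)
      (fun v hv => (hlin v hv).deriv)
    have hκc : κ = 1 - c * p ^ 2 := by
      rw [hκdef, hderiv _ hmp, mul_div_cancel_left₀ _ hb]
      ring
    refine ⟨d, fun z hz hzp => ?_⟩
    have h1 := hd _ (discAut_mem_ball hpa hz)
    have h2 : b = -p ^ 2 / ((1 - (p : ℂ) ^ 2) * (1 - c * p ^ 2)) := by
      rw [← hκc, eq_div_iff (mul_ne_zero hs hκ), ← hbκ]
      ring
    rw [hfG z hz hzp, ← h2]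
    linear_combination h1

/-! ### Joukowski maps and the extremal family -/

/-- The functions with constant parameter `ω`; for `ω = exp (I θ)` these are the extremal ones. -/
noncomputable def parametric (p : ℝ) (ω z : ℂ) : ℂ :=
  (z - (p : ℂ) / (1 + (p : ℂ) ^ 2) * (1 + ω) * z ^ 2) / ((1 - z / (p : ℂ)) * (1 - z * (p : ℂ)))

section Joukowski

variable {c : ℂ}

theorem injOn_joukowski (hc : ‖c‖ ≤ 1) : InjOn (fun v : ℂ => 1 / v + c * v) (ball 0 1 \ {0}) := by
  rintro v ⟨hv, hv0⟩ w ⟨hw, hw0⟩ h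
  have hv0' : v ≠ 0 := hv0
  have hw0' : w ≠ 0 := hw0
  rw [mem_ball_zero_iff] at hv hw
  simp only at h
  field_simp at h
  have h1 : (w - v) * (1 - c * (v * w)) = 0 := by linear_combination h
  rcases mul_eq_zero.1 h1 with h2 | h2
  · exact (sub_eq_zero.1 h2).symm
  · exfalso
    have h3 : ‖c * (v * w)‖ < 1 := by
      rw [norm_mul, norm_mul]
      have : ‖v‖ * ‖w‖ < 1 := by nlinarith [norm_nonneg v, norm_nonneg w]
      nlinarith [norm_nonneg c, mul_nonneg (norm_nonneg v) (norm_nonneg w)]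
    rw [← sub_eq_zero.1 h2] at h3
    simp at h3

/-- The distances to the foci ±2σ are |1 ∓ σv|²/|v|, and the parallelogram law sums them. Circles
about 0 therefore map into confocal ellipses. -/
theorem norm_add_norm_joukowski {σ v : ℂ} (hσ : σ ^ 2 = c) (hv : v ≠ 0) :
    ‖1 / v + c * v - 2 * σ‖ + ‖1 / v + c * v + 2 * σ‖ = 2 * (1 / ‖v‖ + ‖c‖ * ‖v‖) := by
  have h1 : 1 / v + c * v - 2 * σ = (1 - σ * v) ^ 2 / v := by
    rw [← hσ]; field_simp; ring
  have h2 : 1 / v + c * v + 2 * σ = (1 + σ * v) ^ 2 / v := by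
    rw [← hσ]; field_simp; ring
  have h3 : ‖1 - σ * v‖ ^ 2 + ‖1 + σ * v‖ ^ 2 = 2 * (1 + ‖σ‖ ^ 2 * ‖v‖ ^ 2) := by
    have := parallelogram_law_with_norm ℝ (1 : ℂ) (σ * v)
    rw [norm_one, norm_mul] at this
    linear_combination this
  have hv' : ‖v‖ ≠ 0 := norm_ne_zero_iff.2 hv
  rw [h1, h2, norm_div, norm_div, norm_pow, norm_pow, ← add_div, h3, ← hσ, norm_pow]
  field_simp

/-- The image of the punctured disc under the Joukowski map is the exterior of an ellipse. -/
theorem mem_image_joukowski_iff (hc : ‖c‖ ≤ 1) {σ : ℂ} (hσ : σ ^ 2 = c) (w : ℂ) :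
    w ∈ (fun v : ℂ => 1 / v + c * v) '' (ball 0 1 \ {0}) ↔
      2 * (1 + ‖c‖) < ‖w - 2 * σ‖ + ‖w + 2 * σ‖ := by
  constructor
  · rintro ⟨v, ⟨hv, hv0⟩, rfl⟩
    have hv0' : v ≠ 0 := hv0
    rw [mem_ball_zero_iff] at hv
    have hpos : 0 < ‖v‖ := norm_pos_iff.2 hv0'
    simp only
    rw [norm_add_norm_joukowski hσ hv0']
    have h1 : 1 / ‖v‖ + ‖c‖ * ‖v‖ - (1 + ‖c‖) = (1 - ‖v‖) * (1 - ‖c‖ * ‖v‖) / ‖v‖ := by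
      field_simp; ring
    have h2 : 0 < (1 - ‖v‖) * (1 - ‖c‖ * ‖v‖) / ‖v‖ := by
      have : ‖c‖ * ‖v‖ < 1 := by nlinarith [norm_nonneg c]
      exact div_pos (mul_pos (by linarith) (by linarith)) hpos
    linarith
  · intro hw
    obtain ⟨ζ, hζ, hζ0⟩ : ∃ v : ℂ, c * v ^ 2 - w * v + 1 = 0 ∧ v ≠ 0 := by
      rcases eq_or_ne c 0 with rfl | hc0
      · have hσ0 : σ = 0 := by simpa using hσ
        have hw0 : w ≠ 0 := by
          rintro rfl
          simp [hσ0] at hw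
          linarith
        exact ⟨1 / w, by field_simp; ring, by simp [hw0]⟩
      · obtain ⟨δ, hδ⟩ := IsAlgClosed.exists_pow_nat_eq (w ^ 2 - 4 * c) (n := 2) two_pos
        refine ⟨(w + δ) / (2 * c), ?_, ?_⟩
        · field_simp
          linear_combination hδ
        · intro h0
          have hwδ : w + δ = 0 := by
            rcases div_eq_zero_iff.1 h0 with h | h
            · exact h
            · exact absurd h (by simp [hc0])
          have hδ' : δ = -w := by linear_combination hwδ
          rw [hδ'] at hδ
          apply hc0
          linear_combination hδ / 4
    have hwζ : w = 1 / ζ + c * ζ := by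
      field_simp
      linear_combination -hζ
    have hn := norm_add_norm_joukowski hσ hζ0
    rw [← hwζ] at hn
    rw [hn] at hw
    have hpos : 0 < ‖ζ‖ := norm_pos_iff.2 hζ0
    have h1 : 1 / ‖ζ‖ + ‖c‖ * ‖ζ‖ - (1 + ‖c‖) = (1 - ‖ζ‖) * (1 - ‖c‖ * ‖ζ‖) / ‖ζ‖ := by
      field_simp; ring
    have h2 : 0 < (1 - ‖ζ‖) * (1 - ‖c‖ * ‖ζ‖) := by
      have : 0 < (1 - ‖ζ‖) * (1 - ‖c‖ * ‖ζ‖) / ‖ζ‖ := by linarith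
      exact (div_pos_iff_of_pos_right hpos).1 this
    rcases lt_or_ge ‖ζ‖ 1 with h3 | h3
    · exact ⟨ζ, ⟨by simpa using h3, hζ0⟩, hwζ.symm⟩
    · have h4 : 1 < ‖c‖ * ‖ζ‖ := by
        by_contra! h5
        nlinarith [mul_nonneg (sub_nonneg.2 h3) (sub_nonneg.2 h5)]
      have hc0 : c ≠ 0 := by
        rintro rfl
        simp at h4
        linarith
      -- The roots of c v² - w v + 1 have product 1/c, so when ζ lies outside the disc the other
      -- root lies inside.
      refine ⟨1 / (c * ζ), ⟨?_, by simp [hc0, hζ0]⟩, ?_⟩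
      · rw [mem_ball_zero_iff, norm_div, norm_one, norm_mul, div_lt_one (by linarith)]
        exact h4
      · simp only
        rw [hwζ]
        field_simp
        ring

theorem convex_ellipse (a a' : ℂ) (r : ℝ) : Convex ℝ {y : ℂ | ‖y - a‖ + ‖y - a'‖ ≤ r} := by
  have h := ((convexOn_univ_dist a).add (convexOn_univ_dist a')).convex_le r
  have heq : {y : ℂ | ‖y - a‖ + ‖y - a'‖ ≤ r} =
      {x | x ∈ univ ∧ ((fun z => dist z a) + fun z => dist z a') x ≤ r} := by
    ext y
    simp [dist_eq]
  rw [heq]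
  exact h

end Joukowski

section Parametric

variable {p : ℝ} {ω c : ℂ}

theorem one_sub_mul_sq_ne_zero (hp : |p| < 1) (hc : ‖c‖ ≤ 1) : 1 - c * (p : ℂ) ^ 2 ≠ 0 := by
  intro h
  have h1 : ‖c * (p : ℂ) ^ 2‖ < 1 := by
    rw [norm_mul, norm_pow, norm_real, Real.norm_eq_abs]
    nlinarith [norm_nonneg c, abs_nonneg p]
  rw [← sub_eq_zero.1 h] at h1
  simp at h1

/-- The map c ↦ (p² - c)/(1 - c p²) is an involution of the closed disc preserving the unit circle,
so |ω| = 1 exactly when |c| = 1. -/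
theorem norm_parameter_sq (hp : |p| < 1) (hc : ‖c‖ ≤ 1) :
    1 - ‖((p : ℂ) ^ 2 - c) / (1 - c * p ^ 2)‖ ^ 2 =
      (1 - p ^ 4) * (1 - ‖c‖ ^ 2) / ‖1 - c * (p : ℂ) ^ 2‖ ^ 2 := by
  have h0 := one_sub_mul_sq_ne_zero hp hc
  have h1 := normSq_one_sub_sub_normSq (p ^ 2) c
  push_cast at h1
  have h2 : ‖1 - c * (p : ℂ) ^ 2‖ ≠ 0 := norm_ne_zero_iff.2 h0
  rw [mul_comm ((p : ℂ) ^ 2) c, norm_sub_rev c] at h1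
  rw [norm_div, div_pow, eq_div_iff (pow_ne_zero 2 h2), sub_mul,
    div_mul_cancel₀ _ (pow_ne_zero 2 h2)]
  linear_combination h1

theorem parameter_involutive (hp : |p| < 1) (hc : ‖c‖ ≤ 1) :
    ((p : ℂ) ^ 2 - ((p : ℂ) ^ 2 - c) / (1 - c * p ^ 2)) /
      (1 - ((p : ℂ) ^ 2 - c) / (1 - c * p ^ 2) * p ^ 2) = c := by
  have h0 := one_sub_mul_sq_ne_zero hp hc
  have h1 : (1 : ℂ) - p ^ 4 ≠ 0 := by
    have h2 : p ^ 4 < 1 := by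
      have : p ^ 2 < 1 := (sq_lt_one_iff_abs_lt_one p).2 hp
      nlinarith [sq_nonneg p]
    have h3 : (1 - p ^ 4 : ℝ) ≠ 0 := by linarith
    exact_mod_cast h3
  have h2 : 1 - ((p : ℂ) ^ 2 - c) / (1 - c * p ^ 2) * p ^ 2 = (1 - p ^ 4) / (1 - c * p ^ 2) := by
    rw [eq_div_iff h0, sub_mul, div_mul_eq_mul_div, div_mul_cancel₀ _ h0]
    ring
  rw [h2, div_div_eq_mul_div, div_eq_iff h1, sub_mul, div_mul_cancel₀ _ h0]
  ring

theorem one_sub_pow_four_pos (hp : |p| < 1) : 0 < 1 - p ^ 4 := by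
  have : p ^ 2 < 1 := (sq_lt_one_iff_abs_lt_one p).2 hp
  nlinarith [sq_nonneg p]

theorem norm_parameter_le_one (hp : |p| < 1) (hc : ‖c‖ ≤ 1) :
    ‖((p : ℂ) ^ 2 - c) / (1 - c * p ^ 2)‖ ≤ 1 := by
  have h1 := norm_parameter_sq hp hc
  have h2 : 0 ≤ (1 - p ^ 4) * (1 - ‖c‖ ^ 2) / ‖1 - c * (p : ℂ) ^ 2‖ ^ 2 := by
    have := one_sub_pow_four_pos hp
    have h3 : 0 ≤ 1 - ‖c‖ ^ 2 := by nlinarith [norm_nonneg c]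
    positivity
  exact (sq_le_one_iff₀ (norm_nonneg _)).1 (by linarith)

/-- The parametric functions are affine images of Joukowski maps. -/
theorem parametric_eq (hp0 : 0 < p) (hp1 : p < 1) (hc : ‖c‖ ≤ 1)
    (hω : ω = ((p : ℂ) ^ 2 - c) / (1 - c * p ^ 2)) {z : ℂ} (hz : z ∈ ball (0 : ℂ) 1)
    (hzp : z ≠ p) :
    parametric p ω z = -p ^ 2 / ((1 - (p : ℂ) ^ 2) * (1 - c * p ^ 2)) *
      (1 / discAut p z + c * discAut p z) -
      p * (1 + c * p ^ 2) / ((1 - (p : ℂ) ^ 2) * (1 - c * p ^ 2)) := by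
  have hpa : |p| < 1 := by rwa [abs_of_pos hp0]
  have hpc : (p : ℂ) ≠ 0 := by exact_mod_cast hp0.ne'
  have h0 := one_sub_mul_sq_ne_zero hpa hc
  have h1 := ofReal_one_sub_sq_ne_zero hpa
  have h2 := one_sub_mul_ne_zero hpa hz
  have h3 := sub_ne_zero.2 hzp
  have h5 : (1 + (p : ℂ) ^ 2) ≠ 0 := by
    have : (1 + p ^ 2 : ℝ) ≠ 0 := by positivity
    exact_mod_cast this
  have h6 : (p : ℂ) / (1 + (p : ℂ) ^ 2) * (1 + ω) = p * (1 - c) / (1 - c * p ^ 2) := by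
    have h7 : 1 + ω = (1 + (p : ℂ) ^ 2) * (1 - c) / (1 - c * p ^ 2) := by
      rw [hω, eq_div_iff h0, add_mul, div_mul_cancel₀ _ h0]
      ring
    rw [h7]
    field_simp
  have h7 : (1 - z / (p : ℂ)) * (1 - z * p) = -((z - p) * (1 - p * z)) / p := by
    field_simp
    ring
  rw [parametric, h6, h7, discAut]
  -- The nonvanishing factors are made opaque so that `field_simp` clears them as atoms.
  obtain ⟨n, hn⟩ : ∃ n, n = 1 - (p : ℂ) * z := ⟨_, rfl⟩
  obtain ⟨x, hx⟩ : ∃ x, x = z - p := ⟨_, rfl⟩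
  obtain ⟨m, hm⟩ : ∃ m, m = 1 - c * (p : ℂ) ^ 2 := ⟨_, rfl⟩
  obtain ⟨s, hs⟩ : ∃ s, s = 1 - (p : ℂ) ^ 2 := ⟨_, rfl⟩
  rw [← hn] at h2
  rw [← hx] at h3
  rw [← hm] at h0
  rw [← hs] at h1
  rw [← hn, ← hx, ← hm, ← hs]
  field_simp
  rw [hn, hx, hm, hs]
  ring

end Parametric

section Parametric

variable {p : ℝ} {ω : ℂ}

theorem parametric_eq_zpow_smul (hp0 : 0 < p) (ω z : ℂ) :
    parametric p ω z = (z - p) ^ (-1 : ℤ) •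
      (-p * (z - (p : ℂ) / (1 + (p : ℂ) ^ 2) * (1 + ω) * z ^ 2) / (1 - z * p)) := by
  have hpc : (p : ℂ) ≠ 0 := by exact_mod_cast hp0.ne'
  have h1 : 1 - z / (p : ℂ) = -(z - p) * (p : ℂ)⁻¹ := by
    field_simp
    ring
  rw [parametric, h1, zpow_neg_one, smul_eq_mul]
  simp only [div_eq_mul_inv, mul_inv, inv_neg, inv_inv]
  ring

theorem analyticAt_parametric_numerator (hp0 : 0 < p) (hp1 : p < 1) (ω : ℂ) {z : ℂ}
    (hz : z ∈ ball (0 : ℂ) 1) :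
    AnalyticAt ℂ (fun z : ℂ => -p * (z - (p : ℂ) / (1 + (p : ℂ) ^ 2) * (1 + ω) * z ^ 2) /
      (1 - z * p)) z := by
  have hpa : |p| < 1 := by rwa [abs_of_pos hp0]
  exact AnalyticAt.div (by fun_prop) (by fun_prop)
    (by rw [mul_comm]; exact one_sub_mul_ne_zero hpa hz)

theorem parametric_numerator_ne_zero (hp0 : 0 < p) (hp1 : p < 1) (hω : ‖ω‖ ≤ 1) :
    -(p : ℂ) * (p - (p : ℂ) / (1 + (p : ℂ) ^ 2) * (1 + ω) * p ^ 2) / (1 - p * p) ≠ 0 := by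
  have hpa : |p| < 1 := by rwa [abs_of_pos hp0]
  have hpc : (p : ℂ) ≠ 0 := by exact_mod_cast hp0.ne'
  have h5 : (1 + (p : ℂ) ^ 2) ≠ 0 := by
    have : (1 + p ^ 2 : ℝ) ≠ 0 := by positivity
    exact_mod_cast this
  have h1 : (p - (p : ℂ) / (1 + (p : ℂ) ^ 2) * (1 + ω) * p ^ 2) =
      p * (1 - ω * p ^ 2) / (1 + (p : ℂ) ^ 2) := by
    field_simp
    ring
  rw [h1, ← sq (p : ℂ)]
  exact div_ne_zero (mul_ne_zero (neg_ne_zero.2 hpc)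
    (div_ne_zero (mul_ne_zero hpc (one_sub_mul_sq_ne_zero hpa hω)) h5))
    (ofReal_one_sub_sq_ne_zero hpa)

theorem meromorphicNFAt_parametric_pole (hp0 : 0 < p) (hp1 : p < 1) (hω : ‖ω‖ ≤ 1) :
    MeromorphicNFAt (parametric p ω) p :=
  Or.inr ⟨-1, _, analyticAt_parametric_numerator hp0 hp1 ω
    (ofReal_mem_ball (by rwa [abs_of_pos hp0])), parametric_numerator_ne_zero hp0 hp1 hω,
    Eventually.of_forall fun z => parametric_eq_zpow_smul hp0 ω z⟩

theorem meromorphicOrderAt_parametric_pole (hp0 : 0 < p) (hp1 : p < 1) (hω : ‖ω‖ ≤ 1) :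
    meromorphicOrderAt (parametric p ω) p = -1 :=
  (meromorphicOrderAt_eq_int_iff (n := -1)
    (meromorphicNFAt_parametric_pole hp0 hp1 hω).meromorphicAt).2
    ⟨_, analyticAt_parametric_numerator hp0 hp1 ω (ofReal_mem_ball (by rwa [abs_of_pos hp0])),
    parametric_numerator_ne_zero hp0 hp1 hω,
    Eventually.of_forall fun z => parametric_eq_zpow_smul hp0 ω z⟩

theorem analyticAt_parametric (hp0 : 0 < p) (hp1 : p < 1) (ω : ℂ) {z : ℂ}
    (hz : z ∈ ball (0 : ℂ) 1) (hzp : z ≠ p) : AnalyticAt ℂ (parametric p ω) z := by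
  have h1 : AnalyticAt ℂ (fun z : ℂ => (z - (p : ℂ)) ^ (-1 : ℤ)) z :=
    AnalyticAt.fun_zpow (by fun_prop) (sub_ne_zero.2 hzp)
  have h2 := h1.smul (analyticAt_parametric_numerator hp0 hp1 ω hz)
  exact h2.congr (Eventually.of_forall fun z => (parametric_eq_zpow_smul hp0 ω z).symm)

theorem toSphere_parametric (hp0 : 0 < p) (hp1 : p < 1) (ω : ℂ) {z : ℂ}
    (hz : z ∈ ball (0 : ℂ) 1) (hzp : z ≠ p) :
    toSphere (parametric p ω) z = (parametric p ω z : OnePoint ℂ) := by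
  have := (analyticAt_parametric hp0 hp1 ω hz hzp).meromorphicOrderAt_nonneg
  simp [toSphere, not_lt.2 this]

theorem toSphere_parametric_pole (hp0 : 0 < p) (hp1 : p < 1) (hω : ‖ω‖ ≤ 1) :
    toSphere (parametric p ω) p = OnePoint.infty := by
  have hlt : meromorphicOrderAt (parametric p ω) (p : ℂ) < 0 := by
    rw [meromorphicOrderAt_parametric_pole hp0 hp1 hω]; decide
  simp [toSphere, hlt]

theorem hasDerivAt_parametric_zero (p : ℝ) (ω : ℂ) : HasDerivAt (parametric p ω) 1 0 := by
  have h1 : HasDerivAt (fun z : ℂ => z - (p : ℂ) / (1 + (p : ℂ) ^ 2) * (1 + ω) * z ^ 2) 1 0 := by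
    have := (hasDerivAt_id (0 : ℂ)).fun_sub
      ((hasDerivAt_pow 2 (0 : ℂ)).const_mul ((p : ℂ) / (1 + (p : ℂ) ^ 2) * (1 + ω)))
    simpa using this
  have h2 : DifferentiableAt ℂ (fun z : ℂ => (1 - z / (p : ℂ)) * (1 - z * (p : ℂ))) 0 := by
    fun_prop
  refine (h1.fun_div h2.hasDerivAt (by simp)).congr_deriv ?_
  simp

/-- The constants of the Joukowski form of a parametric function. -/
theorem exists_joukowski_parameter (hp : |p| < 1) (hω : ‖ω‖ ≤ 1) :
    ∃ c : ℂ, ‖c‖ ≤ 1 ∧ ω = ((p : ℂ) ^ 2 - c) / (1 - c * p ^ 2) :=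
  ⟨((p : ℂ) ^ 2 - ω) / (1 - ω * p ^ 2), norm_parameter_le_one hp hω,
    (parameter_involutive hp hω).symm⟩

theorem isConcave_parametric (hp0 : 0 < p) (hp1 : p < 1) (hω : ‖ω‖ ≤ 1) :
    IsConcave p (parametric p ω) := by
  have hpa : |p| < 1 := by rwa [abs_of_pos hp0]
  have hpc : (p : ℂ) ≠ 0 := by exact_mod_cast hp0.ne'
  obtain ⟨c, hc, hωc⟩ := exists_joukowski_parameter hpa hω
  have hform := fun z hz hzp => parametric_eq (z := z) hp0 hp1 hc hωc hz hzp
  set b := -(p : ℂ) ^ 2 / ((1 - (p : ℂ) ^ 2) * (1 - c * p ^ 2)) with hb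
  set d := (p : ℂ) * (1 + c * p ^ 2) / ((1 - (p : ℂ) ^ 2) * (1 - c * p ^ 2)) with hd
  have hb0 : b ≠ 0 := div_ne_zero (neg_ne_zero.2 (pow_ne_zero 2 hpc))
    (mul_ne_zero (ofReal_one_sub_sq_ne_zero hpa) (one_sub_mul_sq_ne_zero hpa hc))
  refine ⟨fun z hz => ?_, meromorphicOrderAt_parametric_pole hp0 hp1 hω, by simp [parametric],
    hasDerivAt_parametric_zero p ω, ?_, ?_⟩
  · rcases eq_or_ne z p with rfl | hzp
    · exact meromorphicNFAt_parametric_pole hp0 hp1 hω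
    · exact (analyticAt_parametric hp0 hp1 ω hz hzp).meromorphicNFAt
  · intro z hz w hw hzw
    rcases eq_or_ne z p with rfl | hzp <;> rcases eq_or_ne w p with rfl | hwp
    · rfl
    · rw [toSphere_parametric_pole hp0 hp1 hω, toSphere_parametric hp0 hp1 ω hw hwp] at hzw
      exact absurd hzw (OnePoint.infty_ne_coe _)
    · rw [toSphere_parametric_pole hp0 hp1 hω, toSphere_parametric hp0 hp1 ω hz hzp] at hzw
      exact absurd hzw (OnePoint.coe_ne_infty _)
    · rw [toSphere_parametric hp0 hp1 ω hz hzp, toSphere_parametric hp0 hp1 ω hw hwp] at hzw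
      have h1 := OnePoint.coe_injective hzw
      rw [hform z hz hzp, hform w hw hwp, sub_left_inj, mul_right_inj' hb0] at h1
      have h2 := injOn_joukowski hc ⟨discAut_mem_ball hpa hz, discAut_ne_zero hpa hz hzp⟩
        ⟨discAut_mem_ball hpa hw, discAut_ne_zero hpa hw hwp⟩ h1
      rw [← discAut_neg_discAut hpa hz, h2, discAut_neg_discAut hpa hw]
  · obtain ⟨σ, hσ⟩ := IsAlgClosed.exists_pow_nat_eq c (n := 2) two_pos
    -- The image under w ↦ b w - d of the filled ellipse with foci ±2σ omitted by the Joukowski map;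
    -- distances scale by |b|. For |c| = 1 it degenerates to a segment.
    refine ⟨_, convex_ellipse (2 * σ * b - d) (-(2 * σ * b) - d) (2 * (1 + ‖c‖) * ‖b‖), ?_⟩
    ext y
    induction y using OnePoint.rec with
    | infty =>
      refine iff_of_false (fun h => h ⟨p, ofReal_mem_ball hpa, ?_⟩) ?_
      · exact toSphere_parametric_pole hp0 hp1 hω
      · rintro ⟨w, -, hw⟩
        exact OnePoint.coe_ne_infty _ hw
    | coe y =>
      rw [OnePoint.coe_injective.mem_set_image, mem_compl_iff, not_iff_comm]
      have hscale : ‖y - (2 * σ * b - d)‖ + ‖y - (-(2 * σ * b) - d)‖ =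
          (‖(y + d) / b - 2 * σ‖ + ‖(y + d) / b + 2 * σ‖) * ‖b‖ := by
        rw [add_mul, ← norm_mul, ← norm_mul, sub_mul, add_mul, div_mul_cancel₀ _ hb0]
        congr 2 <;> ring
      have hbpos : 0 < ‖b‖ := norm_pos_iff.2 hb0
      rw [mem_ofPred_eq, hscale, mul_le_mul_iff_left₀ hbpos, not_le,
        ← mem_image_joukowski_iff hc hσ]
      constructor
      · rintro ⟨v, ⟨hv, hv0⟩, hvy⟩
        have hpa' : |-p| < 1 := by rwa [abs_neg]
        have h1 := discAut_mem_ball hpa' hv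
        have h2 := discAut_discAut_neg hpa hv
        have h3 : discAut (-p) v ≠ p := by
          intro h
          rw [h, discAut_self] at h2
          exact hv0 h2.symm
        refine ⟨_, h1, ?_⟩
        rw [toSphere_parametric hp0 hp1 ω h1 h3, hform _ h1 h3, h2]
        simp only at hvy
        rw [hvy, mul_div_cancel₀ _ hb0, add_sub_cancel_right]
      · rintro ⟨z, hz, hzy⟩
        have hzp : z ≠ p := by
          rintro rfl
          rw [toSphere_parametric_pole hp0 hp1 hω] at hzy
          exact OnePoint.infty_ne_coe _ hzy
        rw [toSphere_parametric hp0 hp1 ω hz hzp] at hzy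
        refine ⟨_, ⟨discAut_mem_ball hpa hz, discAut_ne_zero hpa hz hzp⟩, ?_⟩
        simp only
        rw [← OnePoint.coe_injective hzy, hform z hz hzp, sub_add_cancel,
          mul_div_cancel_left₀ _ hb0]

theorem laurentCoeff_of_eq_parametric (hp0 : 0 < p) (hp1 : p < 1) (hω : ‖ω‖ ≤ 1) {f : ℂ → ℂ}
    (hf : ∀ z ∈ ball (0 : ℂ) 1, z ≠ p → f z = parametric p ω z) :
    laurentCoeff p 1 f * ((1 - (p : ℂ) ^ 2) / p) ^ 2 + (p : ℂ) ^ 2 / (1 - (p : ℂ) ^ 4) =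
      ω / (1 - (p : ℂ) ^ 4) := by
  have hpa : |p| < 1 := by rwa [abs_of_pos hp0]
  have hpc : (p : ℂ) ≠ 0 := by exact_mod_cast hp0.ne'
  obtain ⟨c, hc, hωc⟩ := exists_joukowski_parameter hpa hω
  have h0 := one_sub_mul_sq_ne_zero hpa hc
  have h1 := ofReal_one_sub_sq_ne_zero hpa
  have h4 : (1 : ℂ) - p ^ 4 ≠ 0 := by exact_mod_cast (one_sub_pow_four_pos hpa).ne'
  set b := -(p : ℂ) ^ 2 / ((1 - (p : ℂ) ^ 2) * (1 - c * p ^ 2)) with hb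
  set d := (p : ℂ) * (1 + c * p ^ 2) / ((1 - (p : ℂ) ^ 2) * (1 - c * p ^ 2)) with hd
  have hlin : HasDerivAt (fun v : ℂ => b * c * v - d) (b * c) 0 := by
    simpa using ((hasDerivAt_id (0 : ℂ)).const_mul (b * c)).sub_const d
  have hL := laurentCoeff_one_eq (f := f) (b := b) (G := fun v => b * c * v - d) hp0 hp1
    (fun v _ => by fun_prop) (fun z hz hzp => by
      rw [hf z hz hzp, parametric_eq hp0 hp1 hc hωc hz hzp, ← hb, ← hd]
      ring)
  rw [hL, hlin.deriv, hωc, hb]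
  obtain ⟨m, hm⟩ : ∃ m, m = 1 - c * (p : ℂ) ^ 2 := ⟨_, rfl⟩
  obtain ⟨s, hs⟩ : ∃ s, s = 1 - (p : ℂ) ^ 2 := ⟨_, rfl⟩
  obtain ⟨q, hq⟩ : ∃ q, q = 1 - (p : ℂ) ^ 4 := ⟨_, rfl⟩
  rw [← hm] at h0
  rw [← hs] at h1
  rw [← hq] at h4
  rw [← hm, ← hs, ← hq]
  field_simp
  rw [hm, hq]
  ring

end Parametric

/-! ### The coefficient inequality and its equality case -/

/-- With X - c p² = κ, this reduces the coefficient inequality to |c| ≤ |X|. -/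
theorem normSq_sub_sub_normSq (p : ℝ) (X c : ℂ) :
    ‖X - c * (p : ℂ) ^ 2‖ ^ 2 - ‖(p : ℂ) ^ 2 * X - c‖ ^ 2 =
      (1 - p ^ 4) * (‖X‖ ^ 2 - ‖c‖ ^ 2) := by
  rw [← ofReal_pow, ← normSq_eq_norm_sq, ← normSq_eq_norm_sq, ← normSq_eq_norm_sq,
    ← normSq_eq_norm_sq, normSq_apply, normSq_apply, normSq_apply, normSq_apply]
  simp only [sub_re, sub_im, mul_re, mul_im, ofReal_re, ofReal_im]
  ring

/-- The coefficient inequality for concave functions, with the form of the functions for which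
equality holds. -/
theorem IsConcave.norm_laurentCoeff_le {p : ℝ} {f : ℂ → ℂ} (hf : IsConcave p f) (hp0 : 0 < p)
    (hp : p ≤ 3 / 10) :
    ‖laurentCoeff p 1 f * ((1 - (p : ℂ) ^ 2) / p) ^ 2 + (p : ℂ) ^ 2 / (1 - (p : ℂ) ^ 4)‖ ≤
      1 / (1 - p ^ 4) ∧
    (‖laurentCoeff p 1 f * ((1 - (p : ℂ) ^ 2) / p) ^ 2 + (p : ℂ) ^ 2 / (1 - (p : ℂ) ^ 4)‖ =
      1 / (1 - p ^ 4) → ∃ ω : ℂ, ‖ω‖ = 1 ∧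
        ∀ z ∈ ball (0 : ℂ) 1, z ≠ p → f z = parametric p ω z) := by
  have hpa : |p| < 1 := by rw [abs_of_pos hp0]; linarith
  have hpc : (p : ℂ) ≠ 0 := by exact_mod_cast hp0.ne'
  have hq := one_sub_pow_four_pos hpa
  have hqc : (1 : ℂ) - p ^ 4 ≠ 0 := by exact_mod_cast hq.ne'
  obtain ⟨c, κ, hκ, hcoef, hc1, hest, hext⟩ := hf.exists_parameters hp0 hp
  have hid := normSq_sub_sub_normSq p (κ + c * p ^ 2) c
  rw [add_sub_cancel_right] at hid
  have hκn : 0 < ‖κ‖ := norm_pos_iff.2 hκ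
  have hnorm : ‖laurentCoeff p 1 f * ((1 - (p : ℂ) ^ 2) / p) ^ 2 +
      (p : ℂ) ^ 2 / (1 - (p : ℂ) ^ 4)‖ =
      ‖(p : ℂ) ^ 2 * (κ + c * p ^ 2) - c‖ / ‖κ‖ * (1 / (1 - p ^ 4)) := by
    have h1 : -c / κ + (p : ℂ) ^ 2 / (1 - (p : ℂ) ^ 4) =
        ((p : ℂ) ^ 2 * (κ + c * p ^ 2) - c) / κ * (1 / ((1 - p ^ 4 : ℝ) : ℂ)) := by
      push_cast
      field_simp
      ring
    rw [hcoef, h1, norm_mul, norm_div, norm_div, norm_one, norm_real, Real.norm_eq_abs,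
      abs_of_pos hq]
  have hX : ‖c‖ ≤ ‖κ + c * p ^ 2‖ := by linarith
  rw [hnorm]
  constructor
  · refine mul_le_of_le_one_left (by positivity) ((div_le_one hκn).2 ?_)
    rw [← sq_le_sq₀ (norm_nonneg _) (norm_nonneg _)]
    have h2 : 0 ≤ ‖κ + c * p ^ 2‖ ^ 2 - ‖c‖ ^ 2 := by nlinarith [norm_nonneg c]
    nlinarith [mul_nonneg hq.le h2]
  · intro heq
    have h1 : ‖(p : ℂ) ^ 2 * (κ + c * p ^ 2) - c‖ = ‖κ‖ := by
      have h2 : 1 / (1 - p ^ 4) ≠ 0 := (one_div_pos.2 hq).ne'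
      have h3 := mul_right_cancel₀ h2 (heq.trans (one_mul _).symm)
      rwa [div_eq_one_iff_eq hκn.ne'] at h3
    rw [h1, sub_self] at hid
    have h2 : ‖κ + c * p ^ 2‖ ^ 2 - ‖c‖ ^ 2 = 0 := (mul_eq_zero.1 hid.symm).resolve_left hq.ne'
    have h3 : ‖κ + c * p ^ 2‖ = ‖c‖ :=
      (sq_eq_sq₀ (norm_nonneg _) (norm_nonneg _)).1 (sub_eq_zero.1 h2)
    -- From (1 + |c|)/2 ≤ |X| = |c| and |c| ≤ 1.
    have hc : ‖c‖ = 1 := by linarith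
    obtain ⟨d, hd⟩ := hext hc
    have hω1 : ‖((p : ℂ) ^ 2 - c) / (1 - c * p ^ 2)‖ = 1 := by
      have h4 := norm_parameter_sq hpa hc1
      rw [hc, one_pow, sub_self, mul_zero, zero_div, sub_eq_zero] at h4
      exact (pow_eq_one_iff_of_nonneg (norm_nonneg _) two_ne_zero).1 h4.symm
    refine ⟨_, hω1, fun z hz hzp => ?_⟩
    have h0b : (0 : ℂ) ∈ ball (0 : ℂ) 1 := by simp
    have hform := fun z hz hzp =>
      parametric_eq (z := z) hp0 (by linarith) hc1 rfl hz hzp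
    -- The two formulas differ by an additive constant, fixed by the common value 0 at the origin.
    have h5 := hd 0 h0b hpc.symm
    have h6 := hform 0 h0b hpc.symm
    rw [hf.map_zero] at h5
    have h7 : parametric p (((p : ℂ) ^ 2 - c) / (1 - c * p ^ 2)) 0 = 0 := by simp [parametric]
    rw [h7] at h6
    rw [hd z hz hzp, hform z hz hzp]
    linear_combination h6 - h5

end ConcaveUnivalent

theorem theorem4 (p : ℝ) (hp0 : 0 < p) (hp : p ≤ 1 - Real.sqrt 2 / 2) :
    (∀ f ∈ ConcaveUnivalent.Co p, ∀ z : ℂ, 0 < ‖z - (p : ℂ)‖ → ‖z - (p : ℂ)‖ < 1 - p →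
      HasSum (fun k : ℕ => ConcaveUnivalent.laurentCoeff p ((k : ℤ) - 1) f *
        (z - (p : ℂ)) ^ ((k : ℤ) - 1)) (f z)) ∧
    ConcaveUnivalent.laurentCoeff p 1 '' ConcaveUnivalent.Co p =
      {w : ℂ | ‖w * ((1 - (p : ℂ) ^ 2) / (p : ℂ)) ^ 2 + (p : ℂ) ^ 2 / (1 - (p : ℂ) ^ 4)‖
        ≤ 1 / (1 - p ^ 4)} ∧
    ∀ f ∈ ConcaveUnivalent.Co p,
      (‖ConcaveUnivalent.laurentCoeff p 1 f * ((1 - (p : ℂ) ^ 2) / (p : ℂ)) ^ 2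
          + (p : ℂ) ^ 2 / (1 - (p : ℂ) ^ 4)‖ = 1 / (1 - p ^ 4) ↔
        ∃ θ ∈ Set.Icc (0 : ℝ) (2 * Real.pi), ∀ z ∈ Metric.ball (0 : ℂ) 1, z ≠ (p : ℂ) →
          f z = ConcaveUnivalent.extremal p θ z) := by
  have hp3 : p ≤ 3 / 10 := by
    have : (1.4 : ℝ) ≤ Real.sqrt 2 := Real.le_sqrt_of_sq_le (by norm_num)
    linarith
  have hp1 : p < 1 := by linarith
  have hpa : |p| < 1 := by rwa [abs_of_pos hp0]
  have hpc : (p : ℂ) ≠ 0 := by exact_mod_cast hp0.ne'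
  have hq := ConcaveUnivalent.one_sub_pow_four_pos hpa
  have hqc : (1 : ℂ) - p ^ 4 ≠ 0 := by exact_mod_cast hq.ne'
  have hqn : ‖(1 : ℂ) - p ^ 4‖ = 1 - p ^ 4 := by
    rw [show (1 : ℂ) - p ^ 4 = ((1 - p ^ 4 : ℝ) : ℂ) by push_cast; rfl, Complex.norm_real,
      Real.norm_eq_abs, abs_of_pos hq]
  refine ⟨fun f hf z hz0 hz1 => ?_, ?_, fun f hf => ⟨fun heq => ?_, ?_⟩⟩
  · obtain ⟨H, hH, -, hfH⟩ := ConcaveUnivalent.IsConcave.exists_eq_div hf hpa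
    exact ConcaveUnivalent.hasSum_laurent hp0 hp1 hH hfH hz0 hz1
  · refine Set.Subset.antisymm ?_ fun w hw => ?_
    · rintro _ ⟨f, hf, rfl⟩
      exact (ConcaveUnivalent.IsConcave.norm_laurentCoeff_le hf hp0 hp3).1
    · have hs := ConcaveUnivalent.ofReal_one_sub_sq_ne_zero hpa
      have hsp : ((1 - (p : ℂ) ^ 2) / (p : ℂ)) ^ 2 ≠ 0 := pow_ne_zero 2 (div_ne_zero hs hpc)
      -- Solves the coefficient formula `laurentCoeff_of_eq_parametric` for ω; the disc inequality
      -- for `w` becomes |ω| ≤ 1.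
      set ω := (w * ((1 - (p : ℂ) ^ 2) / (p : ℂ)) ^ 2 + (p : ℂ) ^ 2 / (1 - (p : ℂ) ^ 4)) *
        (1 - (p : ℂ) ^ 4) with hω
      have hω1 : ‖ω‖ ≤ 1 := by
        rw [hω, norm_mul, hqn]
        exact (le_div_iff₀ hq).1 hw
      refine ⟨ConcaveUnivalent.parametric p ω, ConcaveUnivalent.isConcave_parametric hp0 hp1 hω1, ?_⟩
      have h1 := ConcaveUnivalent.laurentCoeff_of_eq_parametric hp0 hp1 hω1 (f := ConcaveUnivalent.parametric p ω)
        fun _ _ _ => rfl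
      rw [hω, mul_div_cancel_right₀ _ hqc, ← hω] at h1
      exact mul_right_cancel₀ hsp (add_right_cancel h1)
  · obtain ⟨ω, hω, hfω⟩ := (ConcaveUnivalent.IsConcave.norm_laurentCoeff_le hf hp0 hp3).2 heq
    -- The argument of ω lies in (-π, π]; reducing it modulo 2π puts θ in the required interval.
    have hexp : Complex.exp (Complex.I * (toIcoMod Real.two_pi_pos 0 ω.arg : ℝ)) = ω := by
      have h1 : Complex.exp (Complex.I * (ω.arg : ℝ)) = ω := by
        have := Complex.norm_mul_exp_arg_mul_I ω
        rw [hω, Complex.ofReal_one, one_mul] at this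
        rwa [mul_comm]
      conv_rhs => rw [← h1]
      rw [Complex.exp_eq_exp_iff_exists_int, toIcoMod]
      refine ⟨-toIcoDiv Real.two_pi_pos 0 ω.arg, ?_⟩
      push_cast [zsmul_eq_mul]
      ring
    have hmem := toIcoMod_mem_Ico Real.two_pi_pos 0 ω.arg
    rw [zero_add] at hmem
    refine ⟨_, ⟨hmem.1, hmem.2.le⟩, fun z hz hzp => ?_⟩
    rw [hfω z hz hzp, ConcaveUnivalent.extremal, hexp, ConcaveUnivalent.parametric]
  · rintro ⟨θ, -, hθ⟩
    have hn : ‖Complex.exp (Complex.I * (θ : ℂ))‖ = 1 := by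
      rw [mul_comm]
      exact Complex.norm_exp_ofReal_mul_I θ
    rw [ConcaveUnivalent.laurentCoeff_of_eq_parametric hp0 hp1 hn.le hθ, norm_div, hn, hqn]
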